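/- Let $(M,\mathcal O)$ be a formal manifold, that is, a locally ringed space over $\mathrm{Spec}(\mathbb C)$ with paracompact Hausdorff underlying space in which every point has an open neighbourhood isomorphic to $(\mathbb R^n,\; W\mapsto C^\infty(W)[[y_1,\dots,y_k]])$ for some $n,k\in\mathbb N$ (smooth functions are complex-valued). Let $\underline M=(M,\underline{\mathcal O})$ be its reduction, a smooth manifold, and let $\underline{\mathcal D}$ be the sheaf of complex smooth densities on $\underline M$, regarded as a sheaf of $\mathcal O$-modules through $\mathcal O\to\underline{\mathcal O}$. Let $\mathcal F$ be an arbitrary sheaf of $\mathcal O$-modules. For an open set $U\subset M$ and sheaves of $\mathcal O$-modules $\mathcal F_1,\mathcal F_2$, let $\mathrm{Diff}_c(\mathcal F_1|_U,\mathcal F_2|_U)$ be the space of those homomorphisms of sheaves of complex vector spaces $D:\mathcal F_1|_U\to\mathcal F_2|_U$ that have compact support and are locally differential operators of finite order ($D$ has order $\le r$ on $W$ if $[\cdots[[D|_{W'},f_0],f_1],\cdots,f_r]=0$ for all open $W'\subset W$ and $f_0,\dots,f_r\in\mathcal O(W')$). Equip $\mathcal F(U)$ with the smooth topology, i.e. the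 locally convex topology defined by the seminorms $|s|_D=\sup_{a\in U}|(Ds)(a)|$ with $D\in\mathrm{Diff}_c(\mathcal F|_U,\underline{\mathcal O}|_U)$, and let $\mathcal F(U)'$ be the space of continuous linear functionals on $\mathcal F(U)$. Let $\mathrm D_c^\infty(U;\mathcal F)$ be the image of the linear map $$\rho_U:\mathrm{Diff}_c(\mathcal F|_U,\underline{\mathcal D}|_U)\to\mathrm{Hom}_{\mathbb C}(\mathcal F(U),\mathbb C),\qquad D\mapsto\Big(s\mapsto\int_U D(s)\Big).$$ Then: 1. $\mathrm D_c^\infty(U;\mathcal F)\subset\mathcal F(U)'$ for every open $U\subset M$. 2. For all open $V\subset U\subset M$ the transpose of the restriction map $\mathcal F(U)\to\mathcal F(V)$ maps $\mathrm D_c^\infty(V;\mathcal F)$ into $\mathrm D_c^\infty(U;\mathcal F)$. With these extension maps, $U\mapsto\mathrm D_c^\infty(U;\mathcal F)$ is a precosheaf $\mathrm D_c^\infty(\mathcal F)$ of complex vector spaces on $M$. 3. The precosheaf $\mathcal G=\mathrm D_c^\infty(\mathcal F)$ is a cosheaf: for every family $(U_i)_{i\in I}$ of open subsets of $M$ with union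 $U$, the sequence $$\bigoplus_{(i,j)\in I\times I}\mathcal G(U_i\cap U_j)\to\bigoplus_{i\in I}\mathcal G(U_i)\to\mathcal G(U)\to 0$$ is exact, where the second map is the sum of the extension maps and the first map is, on the summand $(i,j)$, the difference of the extension maps to $\mathcal G(U_i)$ and to $\mathcal G(U_j)$. 4. Moreover $\mathcal G$ is flabby (all extension maps are injective); for all open $U_1,U_2\subset M$ the Mayer–Vietoris sequence $$\mathcal G(U_1\cap U_2)\to\mathcal G(U_1)\oplus\mathcal G(U_2)\to\mathcal G(U_1\cup U_2)\to0$$ with maps $(\mathrm{ext},-\mathrm{ext})$ and $\mathrm{ext}+\mathrm{ext}$ is exact; and for every family $\{U_\alpha\}$ of open subsets directed upwards by inclusion, the canonical map $\varinjlim_\alpha\mathcal G(U_\alpha)\to\mathcal G(\bigcup_\alpha U_\alpha)$ is a linear isomorphism. -/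

import Mathlib

open CategoryTheory TopologicalSpace Opposite AlgebraicGeometry Topology
open scoped ContDiff Manifold

universe u w

noncomputable section

namespace FormalMfd

/-! ### Smooth functions on open subsets of Euclidean space -/

/-- The Euclidean space `ℝⁿ`. -/
abbrev E (n : ℕ) : Type := EuclideanSpace ℝ (Fin n)

/-- The `ℂ`-algebra `C^∞(W)` of complex-valued smooth functions on an open subset `W` of `ℝⁿ`. -/
def smoothFun {n : ℕ} (W : Opens (E n)) : Subalgebra ℂ (W → ℂ) where
  carrier := {f | ContMDiff 𝓘(ℝ, E n) 𝓘(ℝ, ℂ) ∞ f}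
  mul_mem' {f g} hf hg :=
    ContMDiff.comp (g := fun p : ℂ × ℂ => p.1 * p.2) (f := fun x => (f x, g x))
      (contDiff_mul (𝕜 := ℝ) (𝔸 := ℂ) (n := ∞)).contMDiff
      (ContMDiff.prodMk_space (f := f) (g := g) hf hg)
  add_mem' hf hg := ContMDiff.add hf hg
  algebraMap_mem' _ := contMDiff_const

theorem mem_smoothFun {n : ℕ} {W : Opens (E n)} {f : W → ℂ} :
    f ∈ smoothFun W ↔ ContMDiff 𝓘(ℝ, E n) 𝓘(ℝ, ℂ) ∞ f :=
  Iff.rfl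

/-- Restriction `C^∞(W) → C^∞(W')` for `W' ⊆ W`. -/
def smoothRes {n : ℕ} {W' W : Opens (E n)} (h : W' ≤ W) : smoothFun W →ₐ[ℂ] smoothFun W' where
  toFun f := ⟨fun x => f.1 ⟨x.1, h x.2⟩,
    mem_smoothFun.2 ((mem_smoothFun.1 f.2).comp (contMDiff_inclusion h))⟩
  map_one' := rfl
  map_mul' _ _ := rfl
  map_zero' := rfl
  map_add' _ _ := rfl
  commutes' _ := rfl

theorem smoothFun_isUnit {n : ℕ} {W : Opens (E n)} (f : smoothFun W) (hf : ∀ x, f.1 x ≠ 0) :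
    IsUnit f := by
  have hs : ContMDiff 𝓘(ℝ, E n) 𝓘(ℝ, ℂ) ∞ (fun x => (f.1 x)⁻¹) := by
    intro x
    have h1 : ContDiffAt ℝ ∞ (fun z : ℂ => z⁻¹) (f.1 x) := contDiffAt_inv ℝ (hf x)
    exact ContMDiffAt.comp x h1.contMDiffAt (mem_smoothFun.1 f.2 x)
  refine IsUnit.of_mul_eq_one ⟨fun x => (f.1 x)⁻¹, mem_smoothFun.2 hs⟩ ?_
  ext x
  exact mul_inv_cancel₀ (hf x)

/-! ### Locally ringed spaces over `Spec ℂ` and formal manifolds -/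

/-- A locally ringed space over `Spec ℂ`. A morphism from a locally ringed space to `Spec ℂ` is
the same thing as a ring homomorphism from `ℂ` to the ring of global sections. -/
structure ComplexLRS where
  space : LocallyRingedSpace.{u}
  scalar : ℂ →+* space.presheaf.obj (op ⊤)

namespace ComplexLRS

variable (Y : ComplexLRS.{u})

/-- The open subsets of the underlying space. -/
abbrev Op : Type u := Opens Y.space.toTopCat

/-- The sections `𝒪(U)` of the structure sheaf. -/
def O (U : Y.Op) : Type u := Y.space.presheaf.obj (op U)

instance (U : Y.Op) : CommRing (Y.O U) :=
  inferInstanceAs (CommRing (Y.space.presheaf.obj (op U)))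

instance (U : Y.Op) : Algebra ℂ (Y.O U) :=
  ((Y.space.presheaf.map (homOfLE (le_top : U ≤ ⊤)).op).hom.comp Y.scalar).toAlgebra

/-- The restriction map `𝒪(U) → 𝒪(V)`. -/
def res {V U : Y.Op} (h : V ≤ U) : Y.O U →ₐ[ℂ] Y.O V where
  toRingHom := (Y.space.presheaf.map (homOfLE h).op).hom
  commutes' z := by
    change (Y.space.presheaf.map (homOfLE h).op).hom
      ((Y.space.presheaf.map (homOfLE (le_top : U ≤ ⊤)).op).hom (Y.scalar z)) =
      (Y.space.presheaf.map (homOfLE (le_top : V ≤ ⊤)).op).hom (Y.scalar z)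
    rw [← CommRingCat.comp_apply, ← Functor.map_comp]
    rfl

theorem res_res {W V U : Y.Op} (h : W ≤ V) (h' : V ≤ U) (f : Y.O U) :
    Y.res h (Y.res h' f) = Y.res (h.trans h') f := by
  have h1 : Y.space.presheaf.map (homOfLE h').op ≫ Y.space.presheaf.map (homOfLE h).op =
      Y.space.presheaf.map (homOfLE (h.trans h')).op := by
    rw [← Functor.map_comp]
    rfl
  exact congrArg (fun g : Y.space.presheaf.obj (op U) ⟶ Y.space.presheaf.obj (op W) =>
    g.hom f) h1

theorem res_self {U : Y.Op} (f : Y.O U) : Y.res (le_refl U) f = f := by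
  change (Y.space.presheaf.map (𝟙 (op U))).hom f = f
  rw [CategoryTheory.Functor.map_id]
  rfl

/-- The germ at `a ∈ U` of a section over `U`. -/
def germ {U : Y.Op} (a : Y.space) (ha : a ∈ U) : Y.O U →+* Y.space.presheaf.stalk a :=
  (Y.space.presheaf.germ U a ha).hom

theorem germ_res {V U : Y.Op} (h : V ≤ U) (a : Y.space) (ha : a ∈ V) (f : Y.O U) :
    Y.germ a ha (Y.res h f) = Y.germ a (h ha) f :=
  Y.space.presheaf.germ_res_apply (homOfLE h) a ha f

/-- The value `f(a) ∈ 𝒪_a/𝔪_a = ℂ` of `f ∈ 𝒪(U)` at `a ∈ U`: the complex number `z` such that the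
germ of `f - z` at `a` lies in the maximal ideal, i.e. is not a unit. -/
def value {U : Y.Op} (f : Y.O U) (a : U) : ℂ :=
  Classical.epsilon fun z : ℂ => ¬ IsUnit (Y.germ a.1 a.2 (f - algebraMap ℂ (Y.O U) z))

/-- The image of an open subset under an open embedding. -/
def openImage {A B : Type*} [TopologicalSpace A] [TopologicalSpace B] {p : A → B}
    (hp : IsOpenEmbedding p) (W : Opens A) : Opens B :=
  ⟨p '' W, hp.isOpenMap _ W.2⟩

theorem openImage_mono {A B : Type*} [TopologicalSpace A] [TopologicalSpace B] {p : A → B}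
    (hp : IsOpenEmbedding p) {W' W : Opens A} (h : W' ≤ W) :
    openImage hp W' ≤ openImage hp W :=
  Set.image_mono h

/-- A chart: an isomorphism of locally ringed spaces over `Spec ℂ` from `(ℝⁿ)^(k)` (the space `ℝⁿ`
with the sheaf `W ↦ C^∞(W)[[y₁, …, y_k]]`) onto an open subspace of `Y`. It consists of a
homeomorphism `param` onto an open subset and of compatible isomorphisms of `ℂ`-algebras of
sections; the induced ring isomorphisms of stalks are automatically local. -/
structure Chart (n k : ℕ) where
  param : E n → Y.space
  isOpenEmbedding : IsOpenEmbedding param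
  iso (W : Opens (E n)) :
    Y.O (openImage isOpenEmbedding W) ≃ₐ[ℂ] MvPowerSeries (Fin k) (smoothFun W)
  iso_res {W' W : Opens (E n)} (h : W' ≤ W)
    (f : Y.O (openImage isOpenEmbedding W)) :
    iso W' (Y.res (openImage_mono isOpenEmbedding h) f) =
      MvPowerSeries.map (smoothRes h).toRingHom (iso W f)

variable {Y}

namespace Chart

variable {n k : ℕ} (c : Y.Chart n k)

/-- The open subset of `ℝⁿ` corresponding to the open subset `V` of `Y`. -/
def pre (V : Y.Op) : Opens (E n) :=
  ⟨c.param ⁻¹' V, V.2.preimage c.isOpenEmbedding.continuous⟩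

theorem image_pre_le (V : Y.Op) : openImage c.isOpenEmbedding (c.pre V) ≤ V := by
  rintro _ ⟨x, hx, rfl⟩
  exact hx

theorem pre_mono {V' V : Y.Op} (h : V' ≤ V) : c.pre V' ≤ c.pre V := fun _ hx => h hx

/-- The reduction of `f ∈ 𝒪(V)` in the chart: the constant coefficient of the corresponding
formal power series. -/
def red (V : Y.Op) : Y.O V →+* smoothFun (c.pre V) :=
  (MvPowerSeries.constantCoeff (σ := Fin k) (R := smoothFun (c.pre V))).comp
    (((c.iso (c.pre V)).toAlgHom.comp (Y.res (c.image_pre_le V))).toRingHom)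

theorem red_algebraMap (V : Y.Op) (z : ℂ) :
    c.red V (algebraMap ℂ _ z) = algebraMap ℂ _ z := by
  have : (c.iso (c.pre V)).toAlgHom.comp (Y.res (c.image_pre_le V)) (algebraMap ℂ _ z) =
    algebraMap ℂ _ z := AlgHom.commutes _ z
  change MvPowerSeries.constantCoeff (((c.iso (c.pre V)).toAlgHom.comp
    (Y.res (c.image_pre_le V))) (algebraMap ℂ _ z)) = _
  rw [this, MvPowerSeries.algebraMap_apply, MvPowerSeries.constantCoeff_C]

theorem red_res {V' V : Y.Op} (h : V' ≤ V) (f : Y.O V) :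
    c.red V' (Y.res h f) = smoothRes (c.pre_mono h) (c.red V f) := by
  change MvPowerSeries.constantCoeff (c.iso (c.pre V') (Y.res (c.image_pre_le V') (Y.res h f))) =
    smoothRes (c.pre_mono h) (MvPowerSeries.constantCoeff
      (c.iso (c.pre V) (Y.res (c.image_pre_le V) f)))
  rw [Y.res_res]
  have := c.iso_res (c.pre_mono h) (Y.res (c.image_pre_le V) f)
  rw [Y.res_res] at this
  rw [this, MvPowerSeries.constantCoeff_map]
  rfl

theorem isUnit_germ_iff {V : Y.Op} (f : Y.O V) (x : c.pre V) :
    IsUnit (Y.germ (c.param x.1) x.2 f) ↔ (c.red V f).1 x ≠ 0 := by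
  constructor
  · intro h
    obtain ⟨W, i, hW, hu⟩ :=
      RingedSpace.isUnit_res_of_isUnit_germ Y.space.toRingedSpace V f (c.param x.1) x.2 h
    have hu' : IsUnit (Y.res i.le f) := hu
    have h2 := hu'.map (c.red W)
    rw [c.red_res i.le f] at h2
    have h3 := h2.map ((Pi.evalRingHom (fun _ : c.pre W => ℂ) ⟨x.1, hW⟩).comp
      (smoothFun (c.pre W)).subtype)
    exact h3.ne_zero
  · intro h
    let W₀ : Opens (E n) := ⟨Subtype.val '' {y : c.pre V | (c.red V f).1 y ≠ 0},
      (c.pre V).2.isOpenMap_subtype_val _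
        (isOpen_compl_singleton.preimage (mem_smoothFun.1 (c.red V f).2).continuous)⟩
    have hW₀ : W₀ ≤ c.pre V := by
      rintro _ ⟨y, -, rfl⟩
      exact y.2
    have hle : openImage c.isOpenEmbedding W₀ ≤
        openImage c.isOpenEmbedding (c.pre V) :=
      openImage_mono c.isOpenEmbedding hW₀
    have key := c.iso_res hW₀ (Y.res (c.image_pre_le V) f)
    have hu : IsUnit (c.iso W₀ (Y.res hle (Y.res (c.image_pre_le V) f))) := by
      rw [key, MvPowerSeries.isUnit_iff_constantCoeff, MvPowerSeries.constantCoeff_map]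
      refine smoothFun_isUnit _ ?_
      rintro ⟨_, y, hy, rfl⟩
      exact hy
    have hu2 : IsUnit (Y.res hle (Y.res (c.image_pre_le V) f)) := by
      have := hu.map (c.iso W₀).symm
      rwa [AlgEquiv.symm_apply_apply] at this
    rw [Y.res_res] at hu2
    have hm : c.param x.1 ∈ openImage c.isOpenEmbedding W₀ :=
      ⟨x.1, ⟨x, h, rfl⟩, rfl⟩
    have := hu2.map (Y.germ (c.param x.1) hm)
    rwa [Y.germ_res] at this

theorem red_eq_iff {V : Y.Op} (f : Y.O V) (x : c.pre V) (z : ℂ) :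
    (c.red V f).1 x = z ↔
      ¬ IsUnit (Y.germ (c.param x.1) x.2 (f - algebraMap ℂ (Y.O V) z)) := by
  rw [c.isUnit_germ_iff, map_sub, c.red_algebraMap, not_not]
  exact sub_eq_zero.symm

/-- The reduction in a chart is given by the values of `f`. -/
theorem value_param {V : Y.Op} (f : Y.O V) (x : c.pre V) :
    Y.value f ⟨c.param x.1, x.2⟩ = (c.red V f).1 x := by
  have := Classical.epsilon_spec
    (p := fun z : ℂ => ¬ IsUnit (Y.germ (c.param x.1) x.2 (f - algebraMap ℂ (Y.O V) z)))
    ⟨(c.red V f).1 x, (c.red_eq_iff f x _).1 rfl⟩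
  exact ((c.red_eq_iff f x _).2 this).symm

/-- The change of coordinates from the chart `c` to the chart `c'`. -/
def transition {k' : ℕ} (c' : Y.Chart n k') : E n → E n :=
  fun x => (c'.isOpenEmbedding.toOpenPartialHomeomorph c'.param).symm (c.param x)

end Chart

end ComplexLRS

/-- A formal manifold: a locally ringed space over `Spec ℂ`, with paracompact Hausdorff underlying
space, which is locally isomorphic to some `(ℝⁿ)^(k)`. -/
structure FormalManifold extends ComplexLRS.{u} where
  t2Space : T2Space space.toTopCat
  paracompactSpace : ParacompactSpace space.toTopCat
  exists_chart (a : space.toTopCat) : ∃ (n k : ℕ) (c : toComplexLRS.Chart n k), a ∈ Set.range c.param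

/-! ### Sheaves of `𝒪`-modules -/

namespace ComplexLRS

variable (Y : ComplexLRS.{u})

/-- The structure sheaf as a sheaf of rings. -/
abbrev ringSheaf : TopCat.Sheaf RingCat.{u} Y.space.toTopCat :=
  (sheafCompose _ (forget₂ CommRingCat RingCat.{u})).obj Y.space.sheaf

variable {Y}

/-- The sections over `U` of a presheaf of `𝒪`-modules. -/
def Sec (P : PresheafOfModules.{u} Y.ringSheaf.obj) (U : Y.Op) : Type u :=
  P.obj (op U)

namespace Sec

variable (P : PresheafOfModules.{u} Y.ringSheaf.obj)

instance (U : Y.Op) : AddCommGroup (Sec P U) :=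
  inferInstanceAs (AddCommGroup (P.obj (op U)))

instance (U : Y.Op) : Module (Y.O U) (Sec P U) :=
  (P.obj (op U)).isModule

instance (U : Y.Op) : Module ℂ (Sec P U) :=
  Module.compHom _ (algebraMap ℂ (Y.O U))

instance (U : Y.Op) : IsScalarTower ℂ (Y.O U) (Sec P U) :=
  IsScalarTower.of_algebraMap_smul fun _ _ => rfl

/-- The restriction maps of a presheaf of `𝒪`-modules. -/
def resAdd {V U : Y.Op} (h : V ≤ U) : Sec P U →+ Sec P V where
  toFun s := P.map (homOfLE h).op s
  map_zero' := _root_.map_zero (P.map (homOfLE h).op).hom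
  map_add' s t := _root_.map_add (P.map (homOfLE h).op).hom s t

theorem resAdd_smul {V U : Y.Op} (h : V ≤ U) (f : Y.O U) (s : Sec P U) :
    resAdd P h (f • s) = Y.res h f • resAdd P h s :=
  P.map_smul (homOfLE h).op f s

/-- The restriction maps of a presheaf of `𝒪`-modules, as `ℂ`-linear maps. -/
def res {V U : Y.Op} (h : V ≤ U) : Sec P U →ₗ[ℂ] Sec P V where
  toFun := resAdd P h
  map_add' := (resAdd P h).map_add
  map_smul' z s := by
    refine (resAdd_smul P h (algebraMap ℂ (Y.O U) z) s).trans ?_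
    rw [AlgHom.commutes]
    rfl

theorem res_smul {V U : Y.Op} (h : V ≤ U) (f : Y.O U) (s : Sec P U) :
    res P h (f • s) = Y.res h f • res P h s :=
  resAdd_smul P h f s

theorem res_self {U : Y.Op} (s : Sec P U) : res P (le_refl U) s = s := by
  change P.map (𝟙 (op U)) s = s
  rw [PresheafOfModules.map_id]
  rfl

theorem res_res {W V U : Y.Op} (h : W ≤ V) (h' : V ≤ U) (s : Sec P U) :
    res P h (res P h' s) = res P (h.trans h') s :=
  (PresheafOfModules.map_comp_apply P (homOfLE h').op (homOfLE h).op s).symm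

end Sec

end ComplexLRS

namespace FormalManifold

variable (M : FormalManifold.{u})

/-- The open subsets of a formal manifold. -/
abbrev Op : Type u := M.toComplexLRS.Op

instance : T2Space M.space.toTopCat := M.t2Space

instance : ParacompactSpace M.space.toTopCat := M.paracompactSpace

/-! ### The sheaf of smooth functions and the sheaf of smooth densities on the reduction -/

variable {M} in
theorem exists_value_eq {V : M.Op} (a : V) : ∃ φ : M.O V →+* ℂ, ∀ f, M.value f a = φ f := by
  obtain ⟨a, ha⟩ := a
  obtain ⟨n, k, c, x, rfl⟩ := M.exists_chart a
  exact ⟨((Pi.evalRingHom (fun _ : c.pre V => ℂ) ⟨x, ha⟩).comp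
      (smoothFun (c.pre V)).subtype).comp (c.red V), fun f => c.value_param f ⟨x, ha⟩⟩

variable {M} in
theorem value_res {V' V : M.Op} (h : V' ≤ V) (f : M.O V) (a : V') :
    M.value (M.res h f) a = M.value f ⟨a.1, h a.2⟩ := by
  obtain ⟨a, ha⟩ := a
  obtain ⟨n, k, c, x, rfl⟩ := M.exists_chart a
  refine (c.value_param (M.res h f) ⟨x, ha⟩).trans ?_
  rw [c.red_res]
  exact (c.value_param f ⟨x, h ha⟩).symm

/-- The sections over `V` of the structure sheaf of the reduction: the functions on `V` that are
smooth in all charts. -/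
def RedFun (V : M.Op) : AddSubgroup (V → ℂ) where
  carrier := {g | ∀ (n k : ℕ) (c : M.Chart n k),
    (fun x : c.pre V => g ⟨c.param x.1, x.2⟩) ∈ smoothFun (c.pre V)}
  add_mem' hf hg n k c := add_mem (hf n k c) (hg n k c)
  zero_mem' _ _ _ := zero_mem _
  neg_mem' hf n k c := neg_mem (hf n k c)

/-- `f ∈ 𝒪(V)` acts on smooth functions as multiplication by the function `a ↦ f(a)`. -/
instance (V : M.Op) : SMul (M.O V) (M.RedFun V) where
  smul f g := ⟨fun a => M.value f a * g.1 a, fun n k c => by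
    have h := mul_mem (c.red V f).2 (g.2 n k c)
    convert h using 1
    funext x
    exact congrArg (· * _) (c.value_param f x)⟩

variable {M} in
theorem RedFun.smul_apply {V : M.Op} (f : M.O V) (g : M.RedFun V) (a : V) :
    (f • g).1 a = M.value f a * g.1 a := rfl

instance (V : M.Op) : Module (M.O V) (M.RedFun V) where
  one_smul g := by
    ext a
    obtain ⟨φ, hφ⟩ := exists_value_eq a
    simp [RedFun.smul_apply, hφ]
  mul_smul f f' g := by
    ext a
    obtain ⟨φ, hφ⟩ := exists_value_eq a
    simp [RedFun.smul_apply, hφ, mul_assoc]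
  smul_zero f := by
    ext a
    simp [RedFun.smul_apply]
  smul_add f g g' := by
    ext a
    simp [RedFun.smul_apply, mul_add]
  add_smul f f' g := by
    ext a
    obtain ⟨φ, hφ⟩ := exists_value_eq a
    simp [RedFun.smul_apply, hφ, add_mul]
  zero_smul g := by
    ext a
    obtain ⟨φ, hφ⟩ := exists_value_eq a
    simp [RedFun.smul_apply, hφ]

/-- The smooth densities over `V` on the reduction. In local coordinates a density is a smooth
function, and a change of coordinates `τ` multiplies it by `|det Dτ|`. -/
def Density (V : M.Op) : AddSubgroup (∀ (n k : ℕ) (c : M.Chart n k), smoothFun (c.pre V)) where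
  carrier := {d | ∀ (n k k' : ℕ) (c : M.Chart n k) (c' : M.Chart n k')
    (x : c.pre V) (x' : c'.pre V), c.param x.1 = c'.param x'.1 →
      (d n k c).1 x = (|(fderiv ℝ (c.transition c') x.1).det| : ℝ) * (d n k' c').1 x'}
  add_mem' {d e} hd he n k k' c c' x x' h := by
    have h1 := hd n k k' c c' x x' h
    have h2 := he n k k' c c' x x' h
    change (d n k c).1 x + (e n k c).1 x = _ * ((d n k' c').1 x' + (e n k' c').1 x')
    rw [h1, h2, mul_add]
  zero_mem' n k k' c c' x x' _ := (mul_zero _).symm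
  neg_mem' {d} hd n k k' c c' x x' h := by
    have h1 := hd n k k' c c' x x' h
    change -(d n k c).1 x = _ * -(d n k' c').1 x'
    rw [h1, mul_neg]

/-- `f ∈ 𝒪(V)` acts on smooth densities as multiplication by the smooth function `a ↦ f(a)`. -/
instance (V : M.Op) : SMul (M.O V) (M.Density V) where
  smul f d := ⟨fun n k c => c.red V f * d.1 n k c, fun n k k' c c' x x' h => by
    have h1 := d.2 n k k' c c' x x' h
    have h2 : (c.red V f).1 x = (c'.red V f).1 x' := by
      rw [← c.value_param f x, ← c'.value_param f x']
      exact congrArg (M.value f) (Subtype.ext h)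
    change (c.red V f).1 x * (d.1 n k c).1 x = _ * ((c'.red V f).1 x' * (d.1 n k' c').1 x')
    rw [h1, h2]
    ring⟩

variable {M} in
theorem Density.smul_apply {V : M.Op} (f : M.O V) (d : M.Density V) (n k : ℕ) (c : M.Chart n k) :
    (f • d).1 n k c = c.red V f * d.1 n k c := rfl

variable {M} in
theorem Density.ext {V : M.Op} {d e : M.Density V} (h : ∀ n k c, d.1 n k c = e.1 n k c) : d = e :=
  Subtype.ext (funext fun n => funext fun k => funext fun c => h n k c)

instance (V : M.Op) : Module (M.O V) (M.Density V) where
  one_smul d := Density.ext fun n k c => by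
    rw [Density.smul_apply, map_one, one_mul]
  mul_smul f g d := Density.ext fun n k c => by
    simp only [Density.smul_apply, map_mul, mul_assoc]
  smul_zero f := Density.ext fun n k c => mul_zero (c.red V f)
  smul_add f d e := Density.ext fun n k c => mul_add (c.red V f) (d.1 n k c) (e.1 n k c)
  add_smul f g d := Density.ext fun n k c => by
    rw [Density.smul_apply, map_add]
    exact add_mul (c.red V f) (c.red V g) (d.1 n k c)
  zero_smul d := Density.ext fun n k c => by
    rw [Density.smul_apply, map_zero, zero_mul]
    rfl

/-- Restriction of smooth functions on the reduction. -/
def RedFun.res {V' V : M.Op} (h : V' ≤ V) : M.RedFun V →+ M.RedFun V' where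
  toFun g := ⟨fun a => g.1 ⟨a.1, h a.2⟩, fun n k c =>
    (smoothRes (c.pre_mono h) ⟨_, g.2 n k c⟩).2⟩
  map_zero' := rfl
  map_add' _ _ := rfl

/-- Restriction of smooth densities on the reduction. -/
def Density.res {V' V : M.Op} (h : V' ≤ V) : M.Density V →+ M.Density V' where
  toFun d := ⟨fun n k c => smoothRes (c.pre_mono h) (d.1 n k c), fun n k k' c c' x x' hx =>
    d.2 n k k' c c' ⟨x.1, h x.2⟩ ⟨x'.1, h x'.2⟩ hx⟩
  map_zero' := rfl
  map_add' _ _ := rfl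

variable {M} in
theorem RedFun.res_smul {V' V : M.Op} (h : V' ≤ V) (f : M.O V) (g : M.RedFun V) :
    RedFun.res M h (f • g) = M.res h f • RedFun.res M h g :=
  Subtype.ext (funext fun a => congrArg (· * _) (value_res h f a).symm)

variable {M} in
theorem Density.res_smul {V' V : M.Op} (h : V' ≤ V) (f : M.O V) (d : M.Density V) :
    Density.res M h (f • d) = M.res h f • Density.res M h d :=
  Density.ext fun n k c =>
    (map_mul (smoothRes (c.pre_mono h)) (c.red V f) (d.1 n k c)).trans
      (congrArg (· * _) (c.red_res h f).symm)

/-- The structure sheaf of the reduction, as an `𝒪`-module. It is a sheaf; only the underlying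
presheaf enters the notions below. -/
def redSheaf : PresheafOfModules.{u} M.ringSheaf.obj :=
  let A : M.Opᵒᵖ ⥤ Ab.{u} :=
    { obj := fun V => AddCommGrpCat.of (M.RedFun V.unop)
      map := fun i => AddCommGrpCat.ofHom (RedFun.res M i.unop.le)
      map_id := fun _ => rfl
      map_comp := fun _ _ => rfl }
  letI (V : M.Opᵒᵖ) : Module (M.ringSheaf.obj.obj V) (A.obj V) :=
    inferInstanceAs (Module (M.O V.unop) (M.RedFun V.unop))
  PresheafOfModules.ofPresheaf A fun _ _ i f g => RedFun.res_smul i.unop.le f g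

/-- The sheaf of smooth densities on the reduction, as an `𝒪`-module. It is a sheaf; only the
underlying presheaf enters the notions below. -/
def densitySheaf : PresheafOfModules.{u} M.ringSheaf.obj :=
  let A : M.Opᵒᵖ ⥤ Ab.{u} :=
    { obj := fun V => AddCommGrpCat.of (M.Density V.unop)
      map := fun i => AddCommGrpCat.ofHom (Density.res M i.unop.le)
      map_id := fun _ => rfl
      map_comp := fun _ _ => rfl }
  letI (V : M.Opᵒᵖ) : Module (M.ringSheaf.obj.obj V) (A.obj V) :=
    inferInstanceAs (Module (M.O V.unop) (M.Density V.unop))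
  PresheafOfModules.ofPresheaf A fun _ _ i f d => Density.res_smul i.unop.le f d

variable {M}

/-- A section of `densitySheaf`, as a density. -/
def toDensity {V : M.Op} (d : ComplexLRS.Sec M.densitySheaf V) : M.Density V := d

/-- A section of `redSheaf`, as a function. -/
def toFun {V : M.Op} (g : ComplexLRS.Sec M.redSheaf V) : V → ℂ := (show M.RedFun V from g).1

theorem toDensity_smul {V : M.Op} (z : ℂ) (d : ComplexLRS.Sec M.densitySheaf V) (n k : ℕ)
    (c : M.Chart n k) : (toDensity (z • d)).1 n k c = z • (toDensity d).1 n k c := by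
  have : (toDensity (z • d)).1 n k c = c.red V (algebraMap ℂ _ z) * (toDensity d).1 n k c := rfl
  rw [this, c.red_algebraMap, Algebra.smul_def]

theorem toFun_smul {V : M.Op} (z : ℂ) (g : ComplexLRS.Sec M.redSheaf V) (a : V) :
    toFun (z • g) a = z * toFun g a := by
  have h : toFun (z • g) a = M.value (algebraMap ℂ (M.O V) z) a * toFun g a := rfl
  rw [h]
  obtain ⟨a, ha⟩ := a
  obtain ⟨n, k, c, x, rfl⟩ := M.exists_chart a
  congr 1
  refine (c.value_param (algebraMap ℂ (M.O V) z) ⟨x, ha⟩).trans ?_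
  rw [c.red_algebraMap]
  rfl

theorem continuous_toFun {V : M.Op} (g : ComplexLRS.Sec M.redSheaf V) : Continuous (toFun g) := by
  rw [continuous_iff_continuousAt]
  rintro ⟨a, ha⟩
  obtain ⟨n, k, c, x, rfl⟩ := M.exists_chart a
  have ho : IsOpenEmbedding (fun y : c.pre V => (⟨c.param y.1, y.2⟩ : V)) :=
    c.isOpenEmbedding.restrictPreimage (V : Set M.space)
  have hc : Continuous (fun y : c.pre V => toFun g ⟨c.param y.1, y.2⟩) :=
    (mem_smoothFun.1 ((show M.RedFun V from g).2 n k c)).continuous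
  exact (ho.continuousAt_iff (x := ⟨x, ha⟩)).1 hc.continuousAt

end FormalManifold

/-! ### Differential operators -/

section DiffOp

variable {A P Q : Type*} [CommRing A] [Algebra ℂ A] [AddCommGroup P] [Module A P] [Module ℂ P]
  [IsScalarTower ℂ A P] [AddCommGroup Q] [Module A Q] [Module ℂ Q] [IsScalarTower ℂ A Q]

/-- The commutator `[T, f] : u ↦ T (f u) - f (T u)`. -/
def comm (T : P →ₗ[ℂ] Q) (f : A) : P →ₗ[ℂ] Q :=
  T ∘ₗ Algebra.lsmul ℂ ℂ P f - Algebra.lsmul ℂ ℂ Q f ∘ₗ T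

variable (A) in
/-- `T` is a differential operator of order at most `r`:
`[…[[T, f₀], f₁], …, f_r] = 0` for all `f₀, …, f_r`. -/
def HasOrderLE : ℕ → (P →ₗ[ℂ] Q) → Prop
  | 0, T => ∀ f : A, comm T f = 0
  | r + 1, T => ∀ f : A, HasOrderLE r (comm T f)

theorem comm_add (T T' : P →ₗ[ℂ] Q) (f : A) : comm (T + T') f = comm T f + comm T' f := by
  ext u
  simp [comm]
  abel

theorem comm_smul (z : ℂ) (T : P →ₗ[ℂ] Q) (f : A) : comm (z • T) f = z • comm T f := by
  ext u
  simp [comm, smul_sub, smul_comm f z]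

theorem HasOrderLE.zero (r : ℕ) : HasOrderLE A r (0 : P →ₗ[ℂ] Q) := by
  have h (f : A) : comm (0 : P →ₗ[ℂ] Q) f = 0 := by
    ext u
    simp [comm]
  induction r with
  | zero => exact h
  | succ r ih => exact fun f => (h f).symm ▸ ih

theorem HasOrderLE.add {r : ℕ} {T T' : P →ₗ[ℂ] Q} (h : HasOrderLE A r T) (h' : HasOrderLE A r T') :
    HasOrderLE A r (T + T') := by
  induction r generalizing T T' with
  | zero => exact fun f => by rw [comm_add, h f, h' f, add_zero]
  | succ r ih => exact fun f => by rw [comm_add]; exact ih (h f) (h' f)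

theorem HasOrderLE.smul {r : ℕ} (z : ℂ) {T : P →ₗ[ℂ] Q} (h : HasOrderLE A r T) :
    HasOrderLE A r (z • T) := by
  induction r generalizing T with
  | zero => exact fun f => by rw [comm_smul, h f, smul_zero]
  | succ r ih => exact fun f => by rw [comm_smul]; exact ih (h f)

theorem HasOrderLE.succ {r : ℕ} {T : P →ₗ[ℂ] Q} (h : HasOrderLE A r T) :
    HasOrderLE A (r + 1) T := by
  induction r generalizing T with
  | zero => exact fun f => (h f).symm ▸ HasOrderLE.zero 0
  | succ r ih => exact fun f => ih (h f)

theorem HasOrderLE.mono {r s : ℕ} (hrs : r ≤ s) {T : P →ₗ[ℂ] Q} (h : HasOrderLE A r T) :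
    HasOrderLE A s T := by
  induction hrs with
  | refl => exact h
  | step _ ih => exact ih.succ

end DiffOp

namespace ComplexLRS

variable {Y : ComplexLRS.{u}} (P Q : PresheafOfModules.{u} Y.ringSheaf.obj)

/-- The open subsets of `U`. -/
abbrev Sub (U : Y.Op) : Type u := {W : Y.Op // W ≤ U}

/-- Families of `ℂ`-linear maps `P(W) → Q(W)`, for `W ⊆ U` open. -/
abbrev OpFamily (U : Y.Op) : Type u := ∀ W : Sub U, Sec P W.1 →ₗ[ℂ] Sec Q W.1

variable {P Q} {U : Y.Op}

/-- The family is a homomorphism `P|_U → Q|_U` of sheaves of complex vector spaces. -/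
def IsSheafHom (D : OpFamily P Q U) : Prop :=
  ∀ (W' W : Sub U) (h : W'.1 ≤ W.1) (s : Sec P W.1), D W' (Sec.res P h s) = Sec.res Q h (D W s)

/-- `D` has order at most `r` on the open subset `W` of `U`. -/
def HasOrderLEOn (D : OpFamily P Q U) (W : Y.Op) (r : ℕ) : Prop :=
  ∀ W' : Sub U, W'.1 ≤ W → HasOrderLE (Y.O W'.1) r (D W')

/-- `D` vanishes on the open subset `W` of `U`. -/
def VanishesOn (D : OpFamily P Q U) (W : Y.Op) : Prop :=
  ∀ W' : Sub U, W'.1 ≤ W → D W' = 0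

/-- The support of `D`: the points of `U` without an open neighbourhood on which `D` vanishes. -/
def opSupport (D : OpFamily P Q U) : Set Y.space :=
  {a | a ∈ U ∧ ∀ W : Sub U, a ∈ W.1 → ¬ VanishesOn D W.1}

variable (P Q U) in
/-- The space `Diff(P|_U, Q|_U)` of differential operators: the homomorphisms of sheaves of complex
vector spaces which are locally of finite order. -/
def Diff : Submodule ℂ (OpFamily P Q U) where
  carrier := {D | IsSheafHom D ∧ ∀ a ∈ U, ∃ W : Sub U, a ∈ W.1 ∧ ∃ r, HasOrderLEOn D W.1 r}
  zero_mem' := ⟨fun W' W h s => (map_zero (Sec.res Q h)).symm, fun a ha =>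
    ⟨⟨U, le_rfl⟩, ha, 0, fun _ _ => HasOrderLE.zero 0⟩⟩
  add_mem' {D D'} hD hD' := by
    refine ⟨fun W' W h s => ?_, fun a ha => ?_⟩
    · have h1 := hD.1 W' W h s
      have h2 := hD'.1 W' W h s
      change D W' _ + D' W' _ = Sec.res Q h (D W s + D' W s)
      rw [h1, h2, map_add]
    · obtain ⟨W, haW, r, hr⟩ := hD.2 a ha
      obtain ⟨W', haW', r', hr'⟩ := hD'.2 a ha
      refine ⟨⟨W.1 ⊓ W'.1, inf_le_left.trans W.2⟩, ⟨haW, haW'⟩, max r r', fun W'' h => ?_⟩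
      exact ((hr W'' (h.trans inf_le_left)).mono (le_max_left r r')).add
        ((hr' W'' (h.trans inf_le_right)).mono (le_max_right r r'))
  smul_mem' z D hD := by
    refine ⟨fun W' W h s => ?_, fun a ha => ?_⟩
    · have h1 := hD.1 W' W h s
      change z • D W' _ = Sec.res Q h (z • D W s)
      rw [h1, map_smul]
    · obtain ⟨W, haW, r, hr⟩ := hD.2 a ha
      exact ⟨W, haW, r, fun W' h => (hr W' h).smul z⟩

theorem isCompact_opSupport {D : OpFamily P Q U} {K : Set Y.space} (hK : IsCompact K) (hKU : K ⊆ U)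
    (h : opSupport D ⊆ K) : IsCompact (opSupport D) := by
  have hc : opSupport D = K ∩ (⋃ (W : Sub U) (_ : VanishesOn D W.1), (W.1 : Set Y.space))ᶜ := by
    ext a
    simp only [opSupport, Set.mem_ofPred_eq, Set.mem_inter_iff, Set.mem_compl_iff, Set.mem_iUnion,
      not_exists]
    exact ⟨fun ha => ⟨h ha, fun W hW haW => ha.2 W haW hW⟩,
      fun ha => ⟨hKU ha.1, fun W haW hW => ha.2 W hW haW⟩⟩
  rw [hc]
  exact hK.inter_right (isClosed_compl_iff.2
    (isOpen_iUnion fun W => isOpen_iUnion fun _ => W.1.isOpen))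

variable (P Q U) in
/-- The space `Diff_c(P|_U, Q|_U)` of compactly supported differential operators. -/
def Diffc : Submodule ℂ (OpFamily P Q U) where
  carrier := {D | D ∈ Diff P Q U ∧ IsCompact (opSupport D)}
  zero_mem' := by
    refine ⟨zero_mem _, isCompact_opSupport isCompact_empty (Set.empty_subset _) ?_⟩
    exact fun a ha => ha.2 ⟨U, le_rfl⟩ ha.1 fun _ _ => rfl
  add_mem' {D D'} hD hD' := by
    refine ⟨add_mem hD.1 hD'.1, isCompact_opSupport (hD.2.union hD'.2)
      (Set.union_subset (fun a ha => ha.1) (fun a ha => ha.1)) fun a ha => ?_⟩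
    by_contra hn
    rw [Set.mem_union, not_or] at hn
    obtain ⟨h1, h2⟩ := hn
    simp only [opSupport, Set.mem_ofPred_eq, not_and, not_forall, not_not] at h1 h2
    obtain ⟨W, haW, hW⟩ := h1 ha.1
    obtain ⟨W', haW', hW'⟩ := h2 ha.1
    refine ha.2 ⟨W.1 ⊓ W'.1, inf_le_left.trans W.2⟩ ⟨haW, haW'⟩ fun W'' h => ?_
    change D W'' + D' W'' = 0
    rw [hW W'' (h.trans inf_le_left), hW' W'' (h.trans inf_le_right), add_zero]
  smul_mem' z D hD := by
    refine ⟨Submodule.smul_mem _ z hD.1, isCompact_opSupport hD.2 (fun a ha => ha.1)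
      fun a ha => ⟨ha.1, fun W haW hW => ha.2 W haW fun W' h => ?_⟩⟩
    change z • D W' = 0
    rw [hW W' h, smul_zero]

/-- The linear map on sections over `U` given by a differential operator on `U`. -/
def applyTop (D : OpFamily P Q U) : Sec P U →ₗ[ℂ] Sec Q U := D ⟨U, le_rfl⟩

theorem exists_res_applyTop_eq_zero {D : OpFamily P Q U} (hD : IsSheafHom D) {a : Y.space}
    (ha : a ∈ U) (hs : a ∉ opSupport D) :
    ∃ W : Sub U, a ∈ W.1 ∧ ∀ s, Sec.res Q W.2 (applyTop D s) = 0 := by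
  simp only [opSupport, Set.mem_ofPred_eq, not_and, not_forall, not_not] at hs
  obtain ⟨W, haW, hW⟩ := hs ha
  refine ⟨W, haW, fun s => ?_⟩
  have := hD W ⟨U, le_rfl⟩ W.2 s
  rw [hW W le_rfl] at this
  exact this.symm

end ComplexLRS

namespace FormalManifold

open ComplexLRS

variable (M : FormalManifold.{u})

/-! ### The smooth topology -/

section SmoothTopology

variable (P : PresheafOfModules.{u} M.ringSheaf.obj) (U : M.Op)

theorem bddAbove_range_applyTop (D : Diffc P M.redSheaf U) (s : Sec P U) :
    BddAbove (Set.range fun a : U => ‖toFun (applyTop D.1 s) a‖) := by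
  have hK : IsCompact ((Subtype.val : U → M.space) ⁻¹' opSupport D.1) :=
    U.isOpen.isOpenEmbedding_subtypeVal.isInducing.isCompact_preimage_iff
      (fun a ha => ⟨⟨a, ha.1⟩, rfl⟩) |>.2 D.2.2
  obtain ⟨C, hC⟩ := hK.exists_bound_of_continuousOn (continuous_toFun (applyTop D.1 s)).continuousOn
  refine ⟨max C 0, ?_⟩
  rintro _ ⟨a, rfl⟩
  by_cases ha : a.1 ∈ opSupport D.1
  · exact (hC a ha).trans (le_max_left _ _)
  · obtain ⟨W, haW, hW⟩ := exists_res_applyTop_eq_zero D.2.1.1 a.2 ha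
    have h0 : toFun (applyTop D.1 s) a = 0 :=
      congrArg (fun g : Sec M.redSheaf W.1 => toFun g ⟨a.1, haW⟩) (hW s)
    change ‖toFun (applyTop D.1 s) a‖ ≤ _
    rw [h0, norm_zero]
    exact le_max_right _ _

/-- The seminorm `|s|_D = sup_{a ∈ U} |(D s)(a)|` on the sections over `U`, for a compactly
supported differential operator `D` into the structure sheaf of the reduction. -/
def smoothSeminorm : SeminormFamily ℂ (Sec P U) (Diffc P M.redSheaf U) := fun D =>
  Seminorm.of (fun s => ⨆ a : U, ‖toFun (applyTop D.1 s) a‖)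
    (fun s t => by
      rcases isEmpty_or_nonempty U with hU | hU
      · simp [Real.iSup_of_isEmpty]
      refine ciSup_le fun a => ?_
      have h : toFun (applyTop D.1 (s + t)) a =
          toFun (applyTop D.1 s) a + toFun (applyTop D.1 t) a := by
        rw [map_add]
        rfl
      rw [h]
      exact (norm_add_le _ _).trans (add_le_add (le_ciSup (M.bddAbove_range_applyTop P U D s) a)
        (le_ciSup (M.bddAbove_range_applyTop P U D t) a)))
    (fun z s => by
      rw [Real.mul_iSup_of_nonneg (norm_nonneg z)]
      congr 1
      funext a
      rw [map_smul, toFun_smul, norm_mul])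

/-- The smooth topology on the sections over `U`. -/
abbrev smoothTopology : TopologicalSpace (Sec P U) :=
  (M.smoothSeminorm P U).moduleFilterBasis.topology

/-- The space of continuous linear functionals on the sections over `U`. -/
def contDual : Submodule ℂ (Module.Dual ℂ (Sec P U)) where
  carrier := {η | Continuous[M.smoothTopology P U, inferInstance] η}
  zero_mem' := by
    let := M.smoothTopology P U
    exact continuous_zero
  add_mem' {η η'} h h' := by
    let := M.smoothTopology P U
    exact Continuous.add h h'
  smul_mem' z η h := by
    let := M.smoothTopology P U
    exact Continuous.const_smul h z

end SmoothTopology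

/-! ### Integration of compactly supported densities -/

/-- The index type of all charts. -/
abbrev AllCharts : Type u := (n : ℕ) × (k : ℕ) × M.Chart n k

theorem exists_partitionOfUnity :
    ∃ ψ : PartitionOfUnity M.AllCharts M.space.toTopCat Set.univ,
      ψ.IsSubordinate fun i => Set.range i.2.2.param :=
  PartitionOfUnity.exists_isSubordinate isClosed_univ _
    (fun i => i.2.2.isOpenEmbedding.isOpen_range) fun a _ => by
      obtain ⟨n, k, c, hc⟩ := M.exists_chart a
      exact Set.mem_iUnion.2 ⟨⟨n, k, c⟩, hc⟩

/-- A partition of unity subordinate to the cover by all chart domains. -/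
def pou : PartitionOfUnity M.AllCharts M.space.toTopCat Set.univ :=
  M.exists_partitionOfUnity.choose

variable {M} in
/-- The density `ψᵢ d` in the coordinates of the chart `i`, extended by zero. -/
def localDensity {V : M.Op} (d : M.Density V) (i : M.AllCharts) (x : E i.1) : ℂ :=
  (M.pou i (i.2.2.param x) : ℂ) * Function.extend Subtype.val (d.1 i.1 i.2.1 i.2.2).1 0 x

variable {M} in
/-- The integral of a compactly supported density over `V`: the sum over all charts of the Lebesgue
integrals over `ℝⁿ` of the pieces of the density cut out by a partition of unity. By the change of
variables formula it does not depend on the partition of unity. -/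
def integral {V : M.Op} (d : M.Density V) : ℂ :=
  ∑ᶠ i : M.AllCharts, ∫ x : E i.1, localDensity d i x

variable {M} in
/-- `d` vanishes outside a compact subset of `V`. -/
def IsCompactlySupported {V : M.Op} (d : M.Density V) : Prop :=
  ∃ K : Set M.space, IsCompact K ∧ K ⊆ V ∧
    ∀ (n k : ℕ) (c : M.Chart n k) (x : c.pre V), c.param x.1 ∉ K → (d.1 n k c).1 x = 0

variable {M} in
theorem localDensity_eq_zero {V : M.Op} (d : M.Density V) {K : Set M.space}
    (hd : ∀ (n k : ℕ) (c : M.Chart n k) (x : c.pre V), c.param x.1 ∉ K → (d.1 n k c).1 x = 0)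
    (i : M.AllCharts) (x : E i.1) (hx : i.2.2.param x ∉ K ∩ tsupport (M.pou i)) :
    localDensity d i x = 0 := by
  by_cases h1 : i.2.2.param x ∈ tsupport (M.pou i)
  · have hK : i.2.2.param x ∉ K := fun h => hx ⟨h, h1⟩
    by_cases hV : x ∈ i.2.2.pre V
    · have h2 : Function.extend Subtype.val (d.1 i.1 i.2.1 i.2.2).1 0 x =
          (d.1 i.1 i.2.1 i.2.2).1 ⟨x, hV⟩ :=
        Subtype.val_injective.extend_apply _ _ (⟨x, hV⟩ : i.2.2.pre V)
      rw [localDensity, h2, hd _ _ _ ⟨x, hV⟩ hK, mul_zero]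
    · have h2 : Function.extend Subtype.val (d.1 i.1 i.2.1 i.2.2).1 0 x = 0 :=
        Function.extend_apply' _ _ _ fun ⟨y, hy⟩ => hV (hy ▸ y.2)
      rw [localDensity, h2, mul_zero]
  · rw [localDensity, image_eq_zero_of_notMem_tsupport h1, Complex.ofReal_zero, zero_mul]

variable {M} in
theorem integrable_localDensity {V : M.Op} {d : M.Density V} (hd : IsCompactlySupported d)
    (i : M.AllCharts) : MeasureTheory.Integrable (localDensity d i) := by
  obtain ⟨K, hK, hKV, hd⟩ := hd
  have hS : IsCompact (i.2.2.param ⁻¹' (K ∩ tsupport (M.pou i))) :=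
    (i.2.2.isOpenEmbedding.isInducing.isCompact_preimage_iff
      (Set.inter_subset_right.trans (M.exists_partitionOfUnity.choose_spec i))).2
      (hK.inter_right (isClosed_tsupport _))
  have hV : i.2.2.param ⁻¹' (K ∩ tsupport (M.pou i)) ⊆ i.2.2.pre V := fun x hx => hKV hx.1
  have hc : ContinuousOn (localDensity d i) (i.2.2.pre V) := by
    refine ContinuousOn.mul (Complex.continuous_ofReal.comp
      ((M.pou i).continuous.comp i.2.2.isOpenEmbedding.continuous)).continuousOn ?_
    rw [continuousOn_iff_continuous_domRestrict]
    have h3 : Set.domRestrict (i.2.2.pre V : Set (E i.1))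
        (Function.extend Subtype.val (d.1 i.1 i.2.1 i.2.2).1 0) = (d.1 i.1 i.2.1 i.2.2).1 :=
      funext fun x => Subtype.val_injective.extend_apply _ _ x
    rw [h3]
    exact (mem_smoothFun.1 (d.1 i.1 i.2.1 i.2.2).2).continuous
  refine (MeasureTheory.integrableOn_iff_integrable_of_support_subset fun x hx => ?_).1
    ((hc.mono hV).integrableOn_compact hS)
  by_contra hn
  exact hx (localDensity_eq_zero d hd i x hn)

variable {M} in
theorem finite_support_integral {V : M.Op} {d : M.Density V} (hd : IsCompactlySupported d) :
    (Function.support fun i : M.AllCharts => ∫ x : E i.1, localDensity d i x).Finite := by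
  obtain ⟨K, hK, hKV, hd⟩ := hd
  refine (M.pou.locallyFinite_tsupport.finite_nonempty_inter_compact hK).subset fun i hi => ?_
  by_contra hn
  refine hi ?_
  have h0 : localDensity d i = 0 := funext fun x =>
    localDensity_eq_zero d hd i x fun hx => hn ⟨_, hx.2, hx.1⟩
  simp [h0]

variable {M} in
theorem integral_add {V : M.Op} {d e : M.Density V} (hd : IsCompactlySupported d)
    (he : IsCompactlySupported e) : integral (d + e) = integral d + integral e := by
  rw [integral, integral, integral,
    ← finsum_add_distrib (finite_support_integral hd) (finite_support_integral he)]
  refine finsum_congr fun i => ?_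
  rw [← MeasureTheory.integral_add (integrable_localDensity hd i) (integrable_localDensity he i)]
  congr 1
  funext x
  rw [localDensity, localDensity, localDensity, ← mul_add]
  congr 1
  by_cases hV : x ∈ i.2.2.pre V
  · have h2 (d : M.Density V) : Function.extend Subtype.val (d.1 i.1 i.2.1 i.2.2).1 0 x =
        (d.1 i.1 i.2.1 i.2.2).1 ⟨x, hV⟩ :=
      Subtype.val_injective.extend_apply _ _ (⟨x, hV⟩ : i.2.2.pre V)
    rw [h2, h2, h2]
    rfl
  · have h2 (d : M.Density V) : Function.extend Subtype.val (d.1 i.1 i.2.1 i.2.2).1 0 x = 0 :=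
      Function.extend_apply' _ _ _ fun ⟨y, hy⟩ => hV (hy ▸ y.2)
    rw [h2, h2, h2, add_zero]

variable {M} in
theorem integral_smul {V : M.Op} (z : ℂ) (d e : M.Density V)
    (h : ∀ n k c, e.1 n k c = z • d.1 n k c) : integral e = z * integral d := by
  rw [integral, integral, ← smul_eq_mul, smul_finsum]
  refine finsum_congr fun i => ?_
  rw [smul_eq_mul, ← MeasureTheory.integral_const_mul]
  congr 1
  funext x
  rw [localDensity, localDensity, mul_left_comm]
  congr 1
  by_cases hV : x ∈ i.2.2.pre V
  · have h2 (d : M.Density V) : Function.extend Subtype.val (d.1 i.1 i.2.1 i.2.2).1 0 x =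
        (d.1 i.1 i.2.1 i.2.2).1 ⟨x, hV⟩ :=
      Subtype.val_injective.extend_apply _ _ (⟨x, hV⟩ : i.2.2.pre V)
    rw [h2, h2, h]
    rfl
  · have h2 (d : M.Density V) : Function.extend Subtype.val (d.1 i.1 i.2.1 i.2.2).1 0 x = 0 :=
      Function.extend_apply' _ _ _ fun ⟨y, hy⟩ => hV (hy ▸ y.2)
    rw [h2, h2, mul_zero]

/-! ### Compactly supported formal densities -/

section DcInf

variable (F : SheafOfModules.{u} M.ringSheaf)

variable {M} in
theorem isCompactlySupported_applyTop {U : M.Op} (D : Diffc F.val M.densitySheaf U)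
    (s : Sec F.val U) : IsCompactlySupported (toDensity (applyTop D.1 s)) := by
  refine ⟨opSupport D.1, D.2.2, fun a ha => ha.1, fun n k c x hx => ?_⟩
  obtain ⟨W, haW, hW⟩ := exists_res_applyTop_eq_zero D.2.1.1 x.2 hx
  exact congrArg (fun d : Sec M.densitySheaf W.1 => ((toDensity d).1 n k c).1 ⟨x.1, haW⟩) (hW s)

/-- The linear map `ρ_U : D ↦ (s ↦ ∫_U D(s))` from compactly supported differential operators with
values in densities to linear functionals on the sections over `U`. -/
def rho (U : M.Op) : Diffc F.val M.densitySheaf U →ₗ[ℂ] Module.Dual ℂ (Sec F.val U) where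
  toFun D :=
    { toFun := fun s => integral (toDensity (applyTop D.1 s))
      map_add' := fun s t => by
        rw [map_add]
        exact integral_add (isCompactlySupported_applyTop F D s)
          (isCompactlySupported_applyTop F D t)
      map_smul' := fun z s => by
        rw [map_smul]
        exact integral_smul z _ _ (toDensity_smul z _) }
  map_add' D D' := LinearMap.ext fun s =>
    integral_add (isCompactlySupported_applyTop F D s) (isCompactlySupported_applyTop F D' s)
  map_smul' z D := LinearMap.ext fun s =>
    integral_smul z _ _ (toDensity_smul z (applyTop D.1 s))

/-- The space `D_c^∞(U; F)`: the image of `ρ_U`. -/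
def DcInf (U : M.Op) : Submodule ℂ (Module.Dual ℂ (Sec F.val U)) :=
  LinearMap.range (M.rho F U)

/-- The transposes of the restriction maps of `F` map `D_c^∞(V; F)` into `D_c^∞(U; F)`,
for `V ⊆ U`. -/
def HasExtensions : Prop :=
  ∀ (V U : M.Op) (h : V ≤ U), ∀ η ∈ M.DcInf F V, (Sec.res F.val h).dualMap η ∈ M.DcInf F U

/-- The precosheaf `U ↦ D_c^∞(U; F)` of complex vector spaces, whose extension maps are the
transposes of the restriction maps of `F`. -/
def DcInfPrecosheaf (h : M.HasExtensions F) : M.Op ⥤ ModuleCat.{u} ℂ where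
  obj U := ModuleCat.of ℂ (M.DcInf F U)
  map {V U} i := ModuleCat.ofHom ((Sec.res F.val i.le).dualMap.restrict (h V U i.le))
  map_id U := by
    refine ModuleCat.hom_ext (LinearMap.ext fun η => Subtype.ext (LinearMap.ext fun s => ?_))
    exact congrArg η.1 (Sec.res_self F.val s)
  map_comp {W V U} i j := by
    refine ModuleCat.hom_ext (LinearMap.ext fun η => Subtype.ext (LinearMap.ext fun s => ?_))
    exact congrArg η.1 (Sec.res_res F.val i.le j.le s).symm

end DcInf

end FormalManifold

/-! ### Cosheaves -/

section Cosheaf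

variable {X : Type u} [TopologicalSpace X] (G : Opens X ⥤ ModuleCat.{u} ℂ)

open scoped DirectSum Classical in
/-- The map `⨁ᵢ G(Uᵢ) → G(⋃ᵢ Uᵢ)` given by the extension maps. -/
def coverSum {ι : Type w} (U : ι → Opens X) : (⨁ i, G.obj (U i)) →ₗ[ℂ] G.obj (⨆ i, U i) :=
  DirectSum.toModule ℂ ι _ fun i => (G.map (homOfLE (le_iSup U i))).hom

open scoped DirectSum Classical in
/-- The map `⨁_{(i,j)} G(Uᵢ ∩ Uⱼ) → ⨁ᵢ G(Uᵢ)` which on the summand `(i, j)` is the difference of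
the extension maps to `G(Uᵢ)` and to `G(Uⱼ)`. -/
def coverDiff {ι : Type w} (U : ι → Opens X) :
    (⨁ p : ι × ι, G.obj (U p.1 ⊓ U p.2)) →ₗ[ℂ] ⨁ i, G.obj (U i) :=
  DirectSum.toModule ℂ (ι × ι) _ fun p =>
    DirectSum.lof ℂ ι (fun i => G.obj (U i)) p.1 ∘ₗ (G.map (homOfLE inf_le_left)).hom -
      DirectSum.lof ℂ ι (fun i => G.obj (U i)) p.2 ∘ₗ (G.map (homOfLE inf_le_right)).hom

/-- A precosheaf `G` is a cosheaf if `⨁ G(Uᵢ ∩ Uⱼ) → ⨁ G(Uᵢ) → G(⋃ Uᵢ) → 0` is exact for every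
family `(Uᵢ)` of open subsets. -/
def IsCosheaf : Prop :=
  ∀ (ι : Type w) (U : ι → Opens X),
    Function.Exact (coverDiff G U) (coverSum G U) ∧ Function.Surjective (coverSum G U)

/-- A precosheaf is flabby if all its extension maps are injective. -/
def IsFlabby : Prop :=
  ∀ (V U : Opens X) (h : V ≤ U), Function.Injective (G.map (homOfLE h)).hom

/-- The Mayer–Vietoris sequences `G(U₁ ∩ U₂) → G(U₁) ⊕ G(U₂) → G(U₁ ∪ U₂) → 0` are exact. -/
def MayerVietorisExact : Prop :=
  ∀ U₁ U₂ : Opens X,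
    Function.Exact
      ((G.map (homOfLE (inf_le_left : U₁ ⊓ U₂ ≤ U₁))).hom.prod
        (-(G.map (homOfLE (inf_le_right : U₁ ⊓ U₂ ≤ U₂))).hom))
      ((G.map (homOfLE (le_sup_left : U₁ ≤ U₁ ⊔ U₂))).hom.coprod
        (G.map (homOfLE (le_sup_right : U₂ ≤ U₁ ⊔ U₂))).hom) ∧
    Function.Surjective
      ((G.map (homOfLE (le_sup_left : U₁ ≤ U₁ ⊔ U₂))).hom.coprod
        (G.map (homOfLE (le_sup_right : U₂ ≤ U₁ ⊔ U₂))).hom)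

/-- The extension maps from the members of a family `S` of open subsets to its union, as a cocone
on the diagram of the extension maps between members of `S`. -/
def unionCocone (S : Set (Opens X)) :
    Limits.Cocone ((Subtype.mono_coe (· ∈ S)).functor ⋙ G) where
  pt := G.obj (sSup S)
  ι :=
    { app := fun U => G.map (homOfLE (le_sSup U.2))
      naturality := fun U V i =>
        (G.map_comp (homOfLE i.le : U.1 ⟶ V.1) (homOfLE (le_sSup V.2))).symm.trans
          (Category.comp_id _).symm }

/-- `G` commutes with directed unions: for every family `S` of open subsets directed upwards by
inclusion, the extension maps exhibit `G(⋃ S)` as the direct limit of the `G(U)`, `U ∈ S`. -/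
def PreservesDirectedUnions : Prop :=
  ∀ S : Set (Opens X), DirectedOn (· ≤ ·) S → Nonempty (Limits.IsColimit (unionCocone G S))

end Cosheaf

end FormalMfd

end

/-! Two tools carry the proof. The structure sheaf has cutoff sections: for `K` compact inside `V`
open there is a global `f` that is `1` near `K` and `0` near the complement of `V`
(`exists_cutoff`). Operators are local: if `f = 1` near the support of `D`, then `D (f s) = D s`
(`rho_mulDiffc_of_isOneNear`). A density-valued operator with compact support extends by zero to any
larger open set, and this extension induces on functionals the transpose of restriction
(`dualMap_rho_extendOp`); this gives the extension maps.

The extension map to `⊤` is injective: for `η = ρ(D)` and a cutoff `f`, `η(s) = η(f s)`, and `f s`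
extends by zero to a global section because `F` is a sheaf. Hence every `D_c^∞(U; F)` may be viewed
as a subspace `supportedDual F U` of the dual of the global sections, consisting of the functionals
represented by some operator supported in `U`. Cutoffs show that these subspaces turn intersections
of open sets into intersections and, by compactness of supports, arbitrary unions into sums. The map
`ρ` need not be injective: the arguments only use that a functional has some representative with the
right support.

Cosheaf exactness, flabbiness, Mayer–Vietoris and directed unions are then formal consequences of
having such a family of subspaces (`LatticeEmbedding`).

Continuity of `ρ(D)` is a separate estimate. The integral is a finite sum over charts, and each term
is bounded by the volume of a compact set times the sup norm of `f · (D s)_c`, the cut-off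
coefficient of `D s` in the chart; `s ↦ f · (D s)_c` is itself a compactly supported operator into
functions, so it defines one of the seminorms. -/

noncomputable section

namespace FormalMfd

/-! ### Gluing two sections -/

section Gluing

open TopCat

variable {C : Type*} [Category* C] {FC : C → C → Type*} {CC : C → Type*}
  [∀ X Y, FunLike (FC X Y) (CC X) (CC Y)] [ConcreteCategory C FC]
  [Limits.HasLimitsOfSize.{u, u} C] [(forget C).ReflectsIsomorphisms]
  [Limits.PreservesLimitsOfSize.{u, u} (forget C)]

/-- Sections over `V` and `W` which agree over `V ⊓ W` come from a section over `⊤`,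
if `V` and `W` cover the space. -/
theorem exists_glue_pair {X : TopCat.{u}} (F : Sheaf C X) {V W : Opens X} (hVW : V ⊔ W = ⊤)
    (s : ToType (F.obj.obj (op V))) (t : ToType (F.obj.obj (op W)))
    (hst : F.obj.map (homOfLE (inf_le_left : V ⊓ W ≤ V)).op s =
      F.obj.map (homOfLE (inf_le_right : V ⊓ W ≤ W)).op t) :
    ∃ r : ToType (F.obj.obj (op ⊤)), F.obj.map (homOfLE (le_top : V ≤ ⊤)).op r = s ∧
      F.obj.map (homOfLE (le_top : W ≤ ⊤)).op r = t := by
  let Z : ULift.{u} Bool → Opens X := fun b => Bool.rec W V b.down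
  let sf : ∀ b, ToType (F.obj.obj (op (Z b))) := fun b =>
    match b with
    | ⟨true⟩ => s
    | ⟨false⟩ => t
  obtain ⟨r, hr, -⟩ := F.existsUnique_gluing' Z ⊤ (fun b => homOfLE le_top)
    (hVW.symm.le.trans (sup_le (le_iSup Z ⟨true⟩) (le_iSup Z ⟨false⟩))) sf (by
      rintro ⟨_ | _⟩ ⟨_ | _⟩
      · rfl
      -- The overlap in the order `W ⊓ V` is a different object from `V ⊓ W`, so `hst` has to be
      -- transported.
      · have := congrArg (F.obj.map (homOfLE (le_inf inf_le_right inf_le_left :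
          W ⊓ V ≤ V ⊓ W)).op) hst
        rw [← ConcreteCategory.comp_apply, ← ConcreteCategory.comp_apply, ← Functor.map_comp,
          ← Functor.map_comp] at this
        exact this.symm
      · exact hst
      · rfl)
  exact ⟨r, hr ⟨true⟩, hr ⟨false⟩⟩

end Gluing

namespace ComplexLRS

theorem exists_extend_zero (Y : ComplexLRS.{u}) {V W : Y.Op} (hVW : V ⊔ W = ⊤) (f : Y.O V)
    (hf : Y.res (inf_le_left : V ⊓ W ≤ V) f = 0) :
    ∃ g : Y.O ⊤, Y.res le_top g = f ∧ Y.res (le_top : W ≤ ⊤) g = 0 :=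
  exists_glue_pair Y.space.sheaf hVW f (0 : Y.O W)
    (hf.trans (map_zero (Y.res (inf_le_right : V ⊓ W ≤ W))).symm)

/-- The sheaf condition on `F` enters the whole argument only here; it is what makes the extension
maps injective. -/
theorem Sec.exists_extend_zero {Y : ComplexLRS.{u}} (F : SheafOfModules.{u} Y.ringSheaf)
    {V W : Y.Op} (hVW : V ⊔ W = ⊤) (s : Sec F.val V)
    (hs : Sec.res F.val (inf_le_left : V ⊓ W ≤ V) s = 0) :
    ∃ t : Sec F.val ⊤, Sec.res F.val le_top t = s ∧ Sec.res F.val (le_top : W ≤ ⊤) t = 0 :=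
  let G : TopCat.Sheaf Ab.{u} Y.space.toTopCat := ⟨F.val.presheaf, F.isSheaf⟩
  exists_glue_pair G hVW (show ToType (G.obj.obj (op V)) from s)
    (show ToType (G.obj.obj (op W)) from (0 : Sec F.val W))
    (hs.trans (map_zero (Sec.res F.val (inf_le_right : V ⊓ W ≤ W))).symm)

/-! ### Smooth functions as sections over a chart -/

namespace Chart

variable {Y : ComplexLRS.{u}} {n k : ℕ} (c : Y.Chart n k)

/-- The section of the structure sheaf over the domain of a chart given by a smooth function. -/
def lift {W : Opens (E n)} (g : smoothFun W) : Y.O (openImage c.isOpenEmbedding W) :=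
  (c.iso W).symm (MvPowerSeries.C g)

theorem res_lift {W' W : Opens (E n)} (h : W' ≤ W) (g : smoothFun W) :
    Y.res (openImage_mono c.isOpenEmbedding h) (c.lift g) = c.lift (smoothRes h g) := by
  apply (c.iso W').injective
  rw [c.iso_res, lift, lift, AlgEquiv.apply_symm_apply, AlgEquiv.apply_symm_apply,
    MvPowerSeries.map_C]
  rfl

theorem lift_one {W : Opens (E n)} : c.lift (1 : smoothFun W) = 1 := by
  rw [lift, map_one, map_one]

theorem lift_zero {W : Opens (E n)} : c.lift (0 : smoothFun W) = 0 := by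
  rw [lift, map_zero, map_zero]

theorem pre_openImage (W : Opens (E n)) : c.pre (openImage c.isOpenEmbedding W) = W :=
  Opens.ext (Set.preimage_image_eq _ c.isOpenEmbedding.injective)

end Chart

end ComplexLRS

/-- The restriction to an open subset of a smooth function on `ℝⁿ`. -/
def smoothFunOfContDiff {n : ℕ} (W : Opens (E n)) (g : E n → ℂ) (hg : ContDiff ℝ ∞ g) :
    smoothFun W :=
  ⟨fun x => g x.1, mem_smoothFun.2 (hg.contMDiff.comp contMDiff_subtype_val)⟩

/-! ### Cutoff sections of the structure sheaf -/

namespace FormalManifold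

open ComplexLRS

variable {M : FormalManifold.{u}}

/-- `f` restricts to `1` near every point of `K`. -/
def IsOneNear (f : M.O ⊤) (K : Set M.space) : Prop :=
  ∀ a ∈ K, ∃ N : M.Op, a ∈ N ∧ M.res (le_top : N ≤ ⊤) f = 1

/-- `f` vanishes near the complement of `V`. -/
def IsSupportedIn (f : M.O ⊤) (V : M.Op) : Prop :=
  ∃ W : M.Op, V ⊔ W = ⊤ ∧ M.res (le_top : W ≤ ⊤) f = 0

/-- A bump function in a chart, read as a constant power series, extends by zero to a global
section: its support is compact, hence closed in the Hausdorff space. -/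
theorem exists_cutoff_nhd {V : M.Op} {a : M.space} (ha : a ∈ V) :
    ∃ N : M.Op, a ∈ N ∧ ∃ f : M.O ⊤, M.res (le_top : N ≤ ⊤) f = 1 ∧ IsSupportedIn f V := by
  obtain ⟨n, k, c, x, rfl⟩ := M.exists_chart a
  obtain ⟨ε, hε, hball⟩ := Metric.isOpen_iff.1 (c.pre V).isOpen x ha
  -- The bump is `1` on the ball of radius `ε / 4` and `0` at distance at least `ε / 2`; the closed
  -- ball of radius `ε / 2` still lies in the chart preimage of `V`.
  let b : ContDiffBump x := ⟨ε / 4, ε / 2, by positivity, by linarith⟩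
  have hbs : ContDiff ℝ ∞ (fun y => (b y : ℂ)) :=
    Complex.ofRealCLM.contDiff.comp b.contDiff
  have hC : IsCompact (c.param '' Metric.closedBall x (ε / 2)) :=
    (isCompact_closedBall x _).image c.isOpenEmbedding.continuous
  have hCV : c.param '' Metric.closedBall x (ε / 2) ⊆ V := by
    rintro _ ⟨y, hy, rfl⟩
    exact hball ((Metric.mem_closedBall.1 hy).trans_lt (by linarith))
  let W : M.Op := ⟨(c.param '' Metric.closedBall x (ε / 2))ᶜ, hC.isClosed.isOpen_compl⟩
  let R : M.Op := openImage c.isOpenEmbedding ⊤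
  have hRW : R ⊔ W = ⊤ := by
    refine eq_top_iff.2 fun y _ => ?_
    by_cases hy : y ∈ c.param '' Metric.closedBall x (ε / 2)
    · obtain ⟨z, -, rfl⟩ := hy
      exact Or.inl ⟨z, trivial, rfl⟩
    · exact Or.inr hy
  have hVW : V ⊔ W = ⊤ := by
    refine eq_top_iff.2 fun y _ => ?_
    by_cases hy : y ∈ c.param '' Metric.closedBall x (ε / 2)
    · exact Or.inl (hCV hy)
    · exact Or.inr hy
  let g : M.O R := c.lift (smoothFunOfContDiff ⊤ _ hbs)
  have hg0 : M.res (inf_le_left : R ⊓ W ≤ R) g = 0 := by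
    have h1 : R ⊓ W ≤ openImage c.isOpenEmbedding (c.pre W) := by
      rintro _ ⟨⟨y, -, rfl⟩, hy⟩
      exact ⟨y, hy, rfl⟩
    have h2 := c.res_lift (le_top : c.pre W ≤ ⊤) (smoothFunOfContDiff ⊤ _ hbs)
    have h3 : smoothRes (le_top : c.pre W ≤ ⊤) (smoothFunOfContDiff ⊤ _ hbs) = 0 := by
      refine Subtype.ext (funext fun y => ?_)
      have hy : ε / 2 ≤ dist y.1 x := by
        by_contra hlt
        exact y.2 ⟨y.1, (not_le.1 hlt).le, rfl⟩
      have : b y.1 = 0 := b.zero_of_le_dist hy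
      change ((b y.1 : ℝ) : ℂ) = 0
      rw [this, Complex.ofReal_zero]
    rw [h3, c.lift_zero] at h2
    have h4 := congrArg (M.res h1) h2
    rwa [M.res_res, map_zero] at h4
  obtain ⟨f, hfR, hfW⟩ := M.exists_extend_zero hRW g hg0
  let B : Opens (E n) := ⟨Metric.ball x (ε / 4), Metric.isOpen_ball⟩
  refine ⟨openImage c.isOpenEmbedding B, ⟨x, Metric.mem_ball_self (by positivity), rfl⟩, f, ?_,
    W, hVW, hfW⟩
  have h2 := c.res_lift (le_top : B ≤ ⊤) (smoothFunOfContDiff ⊤ _ hbs)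
  have h3 : smoothRes (le_top : B ≤ ⊤) (smoothFunOfContDiff ⊤ _ hbs) = 1 := by
    refine Subtype.ext (funext fun y => ?_)
    have : b y.1 = 1 := b.one_of_mem_closedBall (Metric.ball_subset_closedBall y.2)
    change ((b y.1 : ℝ) : ℂ) = 1
    rw [this, Complex.ofReal_one]
  rw [h3, c.lift_one] at h2
  rw [← h2]
  change _ = M.res _ g
  rw [← hfR, M.res_res]

/-- Cutoff functions: for a compact subset `K` of an open set `V` there is a global section of the
structure sheaf which is `1` near `K` and vanishes near the complement of `V`. -/
theorem exists_cutoff {K : Set M.space} (hK : IsCompact K) {V : M.Op} (hKV : K ⊆ V) :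
    ∃ f : M.O ⊤, IsOneNear f K ∧ IsSupportedIn f V := by
  refine hK.induction_on (p := fun s => ∃ f : M.O ⊤, IsOneNear f s ∧ IsSupportedIn f V)
    ⟨0, fun a ha => ha.elim, ⊤, sup_top_eq _, map_zero _⟩
    (fun s t hst ⟨f, hf, h⟩ => ⟨f, fun a ha => hf a (hst ha), h⟩) ?_ fun a ha => ?_
  · rintro s t ⟨f, hf, W, hW, hfW⟩ ⟨g, hg, W', hW', hgW⟩
    -- This is `1 - (1 - f)(1 - g)`: it is `1` where either factor is `1`, and `0` where both
    -- vanish.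
    refine ⟨f + g - f * g, ?_, W ⊓ W', ?_, ?_⟩
    · rintro a (ha | ha)
      · obtain ⟨N, haN, h⟩ := hf a ha
        exact ⟨N, haN, by rw [map_sub, map_add, map_mul, h]; ring⟩
      · obtain ⟨N, haN, h⟩ := hg a ha
        exact ⟨N, haN, by rw [map_sub, map_add, map_mul, h]; ring⟩
    · rw [sup_inf_left, hW, hW', inf_top_eq]
    · have h1 := congrArg (M.res (inf_le_left : W ⊓ W' ≤ W)) hfW
      have h2 := congrArg (M.res (inf_le_right : W ⊓ W' ≤ W')) hgW
      rw [M.res_res, map_zero] at h1 h2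
      rw [map_sub, map_add, map_mul, h1, h2]
      ring
  · obtain ⟨N, haN, f, hf, hfV⟩ := exists_cutoff_nhd (hKV ha)
    exact ⟨N, mem_nhdsWithin_of_mem_nhds (N.isOpen.mem_nhds haN), f,
      fun b hb => ⟨N, hb, hf⟩, hfV⟩

end FormalManifold

/-! ### Algebra of differential operators -/

section DiffOp

variable {A P Q : Type*} [CommRing A] [Algebra ℂ A] [AddCommGroup P] [Module A P] [Module ℂ P]
  [IsScalarTower ℂ A P] [AddCommGroup Q] [Module A Q] [Module ℂ Q] [IsScalarTower ℂ A Q]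

theorem comm_apply (T : P →ₗ[ℂ] Q) (f : A) (u : P) : comm T f u = T (f • u) - f • T u := rfl

/-- Since `A` is commutative, `[T ∘ f, g] = [T, g] ∘ f`, so precomposition with `f` passes through
all iterated commutators. -/
theorem HasOrderLE.comp_lsmul {r : ℕ} {T : P →ₗ[ℂ] Q} (h : HasOrderLE A r T) (f : A) :
    HasOrderLE A r (T ∘ₗ Algebra.lsmul ℂ ℂ P f) := by
  have key (T : P →ₗ[ℂ] Q) (g : A) :
      comm (T ∘ₗ Algebra.lsmul ℂ ℂ P f) g = comm T g ∘ₗ Algebra.lsmul ℂ ℂ P f := by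
    ext u
    simp [comm_apply, smul_comm f g]
  induction r generalizing T with
  | zero => exact fun g => by rw [key, h g, LinearMap.zero_comp]
  | succ r ih => exact fun g => by rw [key]; exact ih (h g)

theorem HasOrderLE.comp_left {Q' : Type*} [AddCommGroup Q'] [Module A Q'] [Module ℂ Q']
    [IsScalarTower ℂ A Q'] {r : ℕ} {T : P →ₗ[ℂ] Q} (h : HasOrderLE A r T) (L : Q →ₗ[ℂ] Q')
    (hL : ∀ (f : A) q, L (f • q) = f • L q) : HasOrderLE A r (L ∘ₗ T) := by
  have key (T : P →ₗ[ℂ] Q) (g : A) : comm (L ∘ₗ T) g = L ∘ₗ comm T g := by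
    ext u
    simp [comm_apply, hL]
  induction r generalizing T with
  | zero => exact fun g => by rw [key, h g, LinearMap.comp_zero]
  | succ r ih => exact fun g => by rw [key]; exact ih (h g)

/-- The order of an operator can be tested after an injective semilinear map on its target. -/
theorem HasOrderLE.of_injective {A' P' Q' : Type*} [CommRing A'] [Algebra ℂ A'] [AddCommGroup P']
    [Module A' P'] [Module ℂ P'] [IsScalarTower ℂ A' P'] [AddCommGroup Q'] [Module A' Q']
    [Module ℂ Q'] [IsScalarTower ℂ A' Q'] (φ : A → A') (α : P → P') (β : Q →+ Q')
    (hβ : Function.Injective β) (hα : ∀ f u, α (f • u) = φ f • α u)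
    (hβ' : ∀ f q, β (f • q) = φ f • β q) {r : ℕ} {T : P →ₗ[ℂ] Q} {T' : P' →ₗ[ℂ] Q'}
    (hT : ∀ u, β (T u) = T' (α u)) (h : HasOrderLE A' r T') : HasOrderLE A r T := by
  -- The intertwining relation between `T` and `T'` is inherited by the commutators with `f` and `φ
  -- f`, which is what the induction on the order needs.
  have key (T : P →ₗ[ℂ] Q) (T' : P' →ₗ[ℂ] Q') (hT : ∀ u, β (T u) = T' (α u)) (f : A) (u : P) :
      β (comm T f u) = comm T' (φ f) (α u) := by
    rw [comm_apply, comm_apply, map_sub, hT, hα, hβ', hT]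
  induction r generalizing T T' with
  | zero => exact fun f => LinearMap.ext fun u => hβ (by
      rw [key T T' hT, h (φ f), LinearMap.zero_apply, LinearMap.zero_apply, map_zero])
  | succ r ih => exact fun f => ih (key T T' hT f) (h (φ f))

end DiffOp

/-! ### Restricting operators and multiplying them by sections -/

namespace ComplexLRS

variable {Y : ComplexLRS.{u}} {P Q : PresheafOfModules.{u} Y.ringSheaf.obj} {U : Y.Op}

theorem exists_res_apply_eq_zero {D : OpFamily P Q U} (hD : IsSheafHom D) (W : Sub U) {a : Y.space}
    (ha : a ∈ W.1) (hs : a ∉ opSupport D) (s : Sec P W.1) :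
    ∃ (N : Y.Op) (h : N ≤ W.1), a ∈ N ∧ Sec.res Q h (D W s) = 0 := by
  simp only [opSupport, Set.mem_ofPred_eq, not_and, not_forall, not_not] at hs
  obtain ⟨N, haN, hN⟩ := hs (W.2 ha)
  refine ⟨N.1 ⊓ W.1, inf_le_right, ⟨haN, ha⟩, ?_⟩
  have := hD ⟨N.1 ⊓ W.1, inf_le_left.trans N.2⟩ W inf_le_right s
  rw [hN _ inf_le_left] at this
  exact this.symm

/-- Restriction of a family of operators to a smaller open set. -/
def restrictOp {V : Y.Op} (h : V ≤ U) (D : OpFamily P Q U) : OpFamily P Q V :=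
  fun W => D ⟨W.1, W.2.trans h⟩

theorem opSupport_restrictOp {V : Y.Op} (h : V ≤ U) (D : OpFamily P Q U) :
    opSupport (restrictOp h D) ⊆ opSupport D := fun _ ha => ⟨h ha.1, fun W haW hW =>
  ha.2 ⟨V ⊓ W.1, inf_le_left⟩ ⟨ha.1, haW⟩ fun W' h' => hW ⟨W'.1, W'.2.trans h⟩
    (h'.trans inf_le_right)⟩

/-- The hypothesis `hV` keeps the support compact: without it, cutting `D` down to `V` could leave a
support that is not closed in `U`. -/
theorem restrictOp_mem {V : Y.Op} (h : V ≤ U) {D : OpFamily P Q U} (hD : D ∈ Diffc P Q U)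
    (hV : opSupport D ⊆ V) : restrictOp h D ∈ Diffc P Q V := by
  refine ⟨⟨fun W' W hW s => hD.1.1 _ ⟨W.1, W.2.trans h⟩ hW s, fun a ha => ?_⟩,
    isCompact_opSupport hD.2 hV (opSupport_restrictOp h D)⟩
  obtain ⟨W, haW, r, hr⟩ := hD.1.2 a (h ha)
  exact ⟨⟨V ⊓ W.1, inf_le_left⟩, ⟨ha, haW⟩, r, fun W' hW' =>
    hr ⟨W'.1, W'.2.trans h⟩ (hW'.trans inf_le_right)⟩

/-- The composition of a family of operators with multiplication by a section `f`. -/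
def mulOp (D : OpFamily P Q U) (f : Y.O ⊤) : OpFamily P Q U :=
  fun W => D W ∘ₗ Algebra.lsmul ℂ ℂ (Sec P W.1) (Y.res (le_top : W.1 ≤ ⊤) f)

theorem mulOp_apply (D : OpFamily P Q U) (f : Y.O ⊤) (W : Sub U) (s : Sec P W.1) :
    mulOp D f W s = D W (Y.res (le_top : W.1 ≤ ⊤) f • s) := rfl

theorem opSupport_mulOp (D : OpFamily P Q U) (f : Y.O ⊤) :
    opSupport (mulOp D f) ⊆ opSupport D := fun _ ha => ⟨ha.1, fun W haW hW =>
  ha.2 W haW fun W' h' => by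
    change D W' ∘ₗ _ = 0
    rw [hW W' h', LinearMap.zero_comp]⟩

theorem notMem_opSupport_mulOp (D : OpFamily P Q U) {f : Y.O ⊤} {N : Y.Op} {a : Y.space}
    (haN : a ∈ N) (hN : Y.res (le_top : N ≤ ⊤) f = 0) : a ∉ opSupport (mulOp D f) := fun ha =>
  ha.2 ⟨U ⊓ N, inf_le_left⟩ ⟨ha.1, haN⟩ fun W' h' => LinearMap.ext fun s => by
    have h1 := congrArg (Y.res (h'.trans inf_le_right)) hN
    rw [Y.res_res, map_zero] at h1
    rw [mulOp_apply, h1, zero_smul, map_zero, LinearMap.zero_apply]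

theorem mulOp_mem {D : OpFamily P Q U} (hD : D ∈ Diffc P Q U) (f : Y.O ⊤) :
    mulOp D f ∈ Diffc P Q U := by
  refine ⟨⟨fun W' W hW s => ?_, fun a ha => ?_⟩,
    isCompact_opSupport hD.2 (fun _ ha => ha.1) (opSupport_mulOp D f)⟩
  · rw [mulOp_apply, mulOp_apply, ← hD.1.1 W' W hW, Sec.res_smul, Y.res_res]
  · obtain ⟨W, haW, r, hr⟩ := hD.1.2 a ha
    exact ⟨W, haW, r, fun W' h' => (hr W' h').comp_lsmul _⟩

end ComplexLRS

/-! ### Extension of densities by zero -/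

/-- Functions on `W` and on `W'` live on different types; both are compared with the extension of
`f` by zero to `ℝⁿ`, whose smoothness at a point sees neither domain. -/
theorem mem_smoothFun_of_locally {n : ℕ} {W : Opens (E n)} {f : W → ℂ}
    (h : ∀ x : W, ∃ (W' : Opens (E n)) (h : W' ≤ W), x.1 ∈ W' ∧
      (fun y : W' => f ⟨y.1, h y.2⟩) ∈ smoothFun W') : f ∈ smoothFun W := by
  have key : f = fun x : W => Function.extend Subtype.val f 0 x.1 :=
    funext fun x => (Subtype.val_injective.extend_apply f 0 x).symm
  rw [mem_smoothFun]
  intro x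
  obtain ⟨W', hW, hx, hf⟩ := h x
  rw [key]
  refine contMDiffAt_subtype_iff.2 ((contMDiffAt_subtype_iff (x := ⟨x.1, hx⟩)).1 ?_)
  have h2 := mem_smoothFun.1 hf ⟨x.1, hx⟩
  have h3 : (fun y : W' => f ⟨y.1, hW y.2⟩) =
      fun y : W' => Function.extend Subtype.val f 0 y.1 :=
    funext fun y => (Subtype.val_injective.extend_apply f 0 (⟨y.1, hW y.2⟩ : W)).symm
  rwa [h3] at h2

namespace FormalManifold

open ComplexLRS

variable {M : FormalManifold.{u}}

theorem density_ext_apply {V : M.Op} {d e : M.Density V}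
    (h : ∀ (n k : ℕ) (c : M.Chart n k) (x : c.pre V), (d.1 n k c).1 x = (e.1 n k c).1 x) : d = e :=
  Density.ext fun n k c => Subtype.ext (funext fun x => h n k c x)

theorem density_ext_locally {V : M.Op} {d e : Sec M.densitySheaf V}
    (h : ∀ a ∈ V, ∃ (N : M.Op) (hN : N ≤ V), a ∈ N ∧
      Sec.res M.densitySheaf hN d = Sec.res M.densitySheaf hN e) : d = e :=
  density_ext_apply (d := toDensity d) (e := toDensity e) fun n k c x => by
    obtain ⟨N, hN, ha, hr⟩ := h _ x.2
    exact congrArg (fun d : Sec M.densitySheaf N => ((toDensity d).1 n k c).1 ⟨x.1, ha⟩) hr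

/-- Extension by zero to `W` of a density over `W ⊓ V` which vanishes outside a closed
subset of `V`. -/
def Density.extendZero {W V : M.Op} (d : M.Density (W ⊓ V)) {K : Set M.space} (hK : IsClosed K)
    (hd : ∀ (n k : ℕ) (c : M.Chart n k) (x : c.pre (W ⊓ V)),
      c.param x.1 ∉ K → (d.1 n k c).1 x = 0) (hKV : K ⊆ V) : M.Density W := by
  classical
  refine ⟨fun n k c => ⟨fun x => if h : c.param x.1 ∈ V then (d.1 n k c).1 ⟨x.1, x.2, h⟩ else 0,
    mem_smoothFun_of_locally fun x => ?_⟩, fun n k k' c c' x x' hx => ?_⟩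
  -- The open sets `V` and `Kᶜ` cover the space since `K ⊆ V`. The function is a coefficient of `d`
  -- over the first and zero over the second, hence smooth.
  · by_cases hV : c.param x.1 ∈ V
    · refine ⟨c.pre (W ⊓ V), c.pre_mono inf_le_left, ⟨x.2, hV⟩, ?_⟩
      convert (d.1 n k c).2 using 1
      exact funext fun y => dif_pos y.2.2
    · refine ⟨c.pre (W ⊓ ⟨Kᶜ, hK.isOpen_compl⟩), c.pre_mono inf_le_left,
        ⟨x.2, fun h => hV (hKV h)⟩, ?_⟩
      convert zero_mem (smoothFun (c.pre (W ⊓ ⟨Kᶜ, hK.isOpen_compl⟩))) using 1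
      refine funext fun y => ?_
      change dite _ _ _ = (0 : ℂ)
      split_ifs with h
      · exact hd n k c ⟨y.1, y.2.1, h⟩ y.2.2
      · rfl
  · change dite _ _ _ = _ * dite _ _ _
    by_cases hV : c.param x.1 ∈ V
    · rw [dif_pos hV, dif_pos (hx ▸ hV)]
      exact d.2 n k k' c c' ⟨x.1, x.2, hV⟩ ⟨x'.1, x'.2, hx ▸ hV⟩ hx
    · rw [dif_neg hV, dif_neg (hx ▸ hV), mul_zero]

theorem Density.extendZero_apply_of_mem {W V : M.Op} (d : M.Density (W ⊓ V)) {K : Set M.space}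
    (hK : IsClosed K) (hd : ∀ (n k : ℕ) (c : M.Chart n k) (x : c.pre (W ⊓ V)),
      c.param x.1 ∉ K → (d.1 n k c).1 x = 0) (hKV : K ⊆ V) {n k : ℕ} (c : M.Chart n k)
    (x : c.pre W) (hx : c.param x.1 ∈ V) :
    ((Density.extendZero d hK hd hKV).1 n k c).1 x = (d.1 n k c).1 ⟨x.1, x.2, hx⟩ :=
  dif_pos hx

theorem Density.extendZero_apply_of_notMem {W V : M.Op} (d : M.Density (W ⊓ V)) {K : Set M.space}
    (hK : IsClosed K) (hd : ∀ (n k : ℕ) (c : M.Chart n k) (x : c.pre (W ⊓ V)),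
      c.param x.1 ∉ K → (d.1 n k c).1 x = 0) (hKV : K ⊆ V) {n k : ℕ} (c : M.Chart n k)
    (x : c.pre W) (hx : c.param x.1 ∉ V) :
    ((Density.extendZero d hK hd hKV).1 n k c).1 x = 0 :=
  dif_neg hx

/-- The integral of a density which vanishes outside `V` is the integral of its restriction
to `V`. -/
theorem integral_eq_of_eqOn {V U : M.Op} (h : V ≤ U) {d : M.Density U} {e : M.Density V}
    (he : ∀ (n k : ℕ) (c : M.Chart n k) (x : c.pre V),
      (d.1 n k c).1 ⟨x.1, h x.2⟩ = (e.1 n k c).1 x)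
    (hd : ∀ (n k : ℕ) (c : M.Chart n k) (x : c.pre U), c.param x.1 ∉ V → (d.1 n k c).1 x = 0) :
    integral d = integral e := by
  -- Both integrals are formed with the same partition of unity, so the integrands agree in each
  -- chart and no change of variables is needed.
  refine finsum_congr fun i => ?_
  congr 1
  funext x
  rw [localDensity, localDensity]
  congr 1
  by_cases hV : x ∈ i.2.2.pre V
  · exact (Subtype.val_injective.extend_apply _ _ (⟨x, h hV⟩ : i.2.2.pre U)).trans
      ((he _ _ _ ⟨x, hV⟩).trans
        (Subtype.val_injective.extend_apply _ _ (⟨x, hV⟩ : i.2.2.pre V)).symm)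
  · rw [Function.extend_apply' (e.1 i.1 i.2.1 i.2.2).1 _ x fun ⟨y, hy⟩ => hV (hy ▸ y.2)]
    by_cases hU : x ∈ i.2.2.pre U
    · exact (Subtype.val_injective.extend_apply _ _ (⟨x, hU⟩ : i.2.2.pre U)).trans
        (hd _ _ _ ⟨x, hU⟩ hV)
    · exact Function.extend_apply' _ _ _ fun ⟨y, hy⟩ => hU (hy ▸ y.2)

section ExtendOp

variable {P : PresheafOfModules.{u} M.ringSheaf.obj} {V : M.Op}

theorem toDensity_apply_eq_zero {D : OpFamily P M.densitySheaf V} (hD : IsSheafHom D) (W : ComplexLRS.Sub V)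
    (s : Sec P W.1) (n k : ℕ) (c : M.Chart n k) (x : c.pre W.1) (hx : c.param x.1 ∉ opSupport D) :
    ((toDensity (D W s)).1 n k c).1 x = 0 := by
  obtain ⟨N, h, ha, hN⟩ := exists_res_apply_eq_zero hD W x.2 hx s
  exact congrArg (fun d : Sec M.densitySheaf N => ((toDensity d).1 n k c).1 ⟨x.1, ha⟩) hN

/-- The value on a section over `W` of the extension by zero of a compactly supported operator
over `V`. -/
def extendDensity (D : Diffc P M.densitySheaf V) {W : M.Op} (s : Sec P W) : M.Density W :=
  Density.extendZero
    (toDensity (D.1 ⟨W ⊓ V, inf_le_right⟩ (Sec.res P (inf_le_left : W ⊓ V ≤ W) s)))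
    D.2.2.isClosed (toDensity_apply_eq_zero D.2.1.1 ⟨W ⊓ V, inf_le_right⟩ _) fun _ ha => ha.1

theorem extendDensity_apply_of_mem (D : Diffc P M.densitySheaf V) {W : M.Op} (s : Sec P W)
    {n k : ℕ} (c : M.Chart n k) (x : c.pre W) (hx : c.param x.1 ∈ V) :
    ((extendDensity D s).1 n k c).1 x =
      ((toDensity (D.1 ⟨W ⊓ V, inf_le_right⟩ (Sec.res P (inf_le_left : W ⊓ V ≤ W) s))).1 n k c).1
        ⟨x.1, x.2, hx⟩ :=
  Density.extendZero_apply_of_mem _ _ _ _ _ _ hx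

theorem extendDensity_apply_of_notMem (D : Diffc P M.densitySheaf V) {W : M.Op} (s : Sec P W)
    {n k : ℕ} (c : M.Chart n k) (x : c.pre W) (hx : c.param x.1 ∉ V) :
    ((extendDensity D s).1 n k c).1 x = 0 :=
  Density.extendZero_apply_of_notMem _ _ _ _ _ _ hx

/-- Extension by zero of a compactly supported operator with values in densities. -/
def extendOp (U : M.Op) (D : Diffc P M.densitySheaf V) : OpFamily P M.densitySheaf U := fun W =>
  { toFun := fun s => show M.Density W.1 from extendDensity D s
    map_add' := fun s t => density_ext_apply fun n k c x => by
      change _ = ((extendDensity D s).1 n k c).1 x + ((extendDensity D t).1 n k c).1 x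
      by_cases hx : c.param x.1 ∈ V
      · refine (extendDensity_apply_of_mem D _ c x hx).trans ?_
        rw [extendDensity_apply_of_mem D s c x hx, extendDensity_apply_of_mem D t c x hx,
          map_add, map_add]
        rfl
      · refine (extendDensity_apply_of_notMem D _ c x hx).trans ?_
        rw [extendDensity_apply_of_notMem D s c x hx, extendDensity_apply_of_notMem D t c x hx,
          add_zero]
    map_smul' := fun z s => density_ext_apply fun n k c x => by
      refine Eq.trans ?_ (congrFun (congrArg Subtype.val
        (toDensity_smul z (show M.Density W.1 from extendDensity D s) n k c)) x).symm
      change _ = z * ((extendDensity D s).1 n k c).1 x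
      by_cases hx : c.param x.1 ∈ V
      · refine (extendDensity_apply_of_mem D _ c x hx).trans ?_
        rw [extendDensity_apply_of_mem D s c x hx, map_smul, map_smul, toDensity_smul]
        rfl
      · refine (extendDensity_apply_of_notMem D _ c x hx).trans ?_
        rw [extendDensity_apply_of_notMem D s c x hx, mul_zero] }

theorem extendOp_apply_of_mem {U : M.Op} (D : Diffc P M.densitySheaf V) (W : ComplexLRS.Sub U)
    (s : Sec P W.1) {n k : ℕ} (c : M.Chart n k) (x : c.pre W.1) (hx : c.param x.1 ∈ V) :
    ((toDensity (extendOp U D W s)).1 n k c).1 x =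
      ((toDensity (D.1 ⟨W.1 ⊓ V, inf_le_right⟩
        (Sec.res P (inf_le_left : W.1 ⊓ V ≤ W.1) s))).1 n k c).1 ⟨x.1, x.2, hx⟩ :=
  extendDensity_apply_of_mem D s c x hx

theorem extendOp_apply_of_notMem {U : M.Op} (D : Diffc P M.densitySheaf V) (W : ComplexLRS.Sub U)
    (s : Sec P W.1) {n k : ℕ} (c : M.Chart n k) (x : c.pre W.1) (hx : c.param x.1 ∉ V) :
    ((toDensity (extendOp U D W s)).1 n k c).1 x = 0 :=
  extendDensity_apply_of_notMem D s c x hx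

theorem extendOp_apply_eq_zero {U : M.Op} (D : Diffc P M.densitySheaf V) (W : ComplexLRS.Sub U)
    (s : Sec P W.1) {n k : ℕ} (c : M.Chart n k) (x : c.pre W.1) (hx : c.param x.1 ∉ opSupport D.1) :
    ((toDensity (extendOp U D W s)).1 n k c).1 x = 0 := by
  by_cases hV : c.param x.1 ∈ V
  · rw [extendOp_apply_of_mem D W s c x hV]
    exact toDensity_apply_eq_zero D.2.1.1 _ _ _ _ _ _ hx
  · exact extendOp_apply_of_notMem D W s c x hV

theorem opSupport_extendOp (U : M.Op) (D : Diffc P M.densitySheaf V) :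
    opSupport (extendOp U D) ⊆ opSupport D.1 := by
  intro a ha
  by_contra hn
  exact ha.2 ⟨U ⊓ ⟨(opSupport D.1)ᶜ, D.2.2.isClosed.isOpen_compl⟩, inf_le_left⟩ ⟨ha.1, hn⟩
    fun W' h' => LinearMap.ext fun s => density_ext_apply fun n k c x =>
      extendOp_apply_eq_zero D W' s c x (h' x.2).2

theorem isSheafHom_extendOp (U : M.Op) (D : Diffc P M.densitySheaf V) :
    IsSheafHom (extendOp U D) := by
  intro W' W h s
  refine density_ext_apply fun n k c x => ?_
  by_cases hx : c.param x.1 ∈ V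
  · have h1 := D.2.1.1 ⟨W'.1 ⊓ V, inf_le_right⟩ ⟨W.1 ⊓ V, inf_le_right⟩
      (inf_le_inf_right V h) (Sec.res P inf_le_left s)
    rw [Sec.res_res] at h1
    refine (extendOp_apply_of_mem D W' _ c x hx).trans ?_
    rw [Sec.res_res, h1]
    exact (extendOp_apply_of_mem D W s c ⟨x.1, h x.2⟩ hx).symm
  · exact (extendOp_apply_of_notMem D W' _ c x hx).trans
      (extendOp_apply_of_notMem D W s c ⟨x.1, h x.2⟩ hx).symm

/-- Finite order is local: near a point of `V` the extension is `D` up to restriction, and near a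
point outside `V` it is zero, because the support of `D` is compact and hence closed. -/
theorem extendOp_mem {U : M.Op} (h : V ≤ U) (D : Diffc P M.densitySheaf V) :
    extendOp U D ∈ Diffc P M.densitySheaf U := by
  refine ⟨⟨isSheafHom_extendOp U D, fun a ha => ?_⟩, isCompact_opSupport D.2.2
    (fun a ha => h ha.1) (opSupport_extendOp U D)⟩
  by_cases hV : a ∈ V
  · obtain ⟨W, haW, r, hr⟩ := D.2.1.2 a hV
    refine ⟨⟨W.1, W.2.trans h⟩, haW, r, fun W' h' => ?_⟩
    -- As `W' ≤ V`, the open sets `W' ⊓ V` and `W'` have the same points but different types of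
    -- sections. The order is therefore compared through restriction, which is injective on
    -- densities.
    refine HasOrderLE.of_injective (M.res (inf_le_left : W'.1 ⊓ V ≤ W'.1))
      (Sec.res P (inf_le_left : W'.1 ⊓ V ≤ W'.1))
      (Sec.resAdd M.densitySheaf (inf_le_left : W'.1 ⊓ V ≤ W'.1)) ?_
      (Sec.res_smul P _) (Sec.res_smul M.densitySheaf _) (fun s => ?_)
      (hr ⟨W'.1 ⊓ V, inf_le_right⟩ (inf_le_left.trans h'))
    · intro d e hde
      exact density_ext_locally fun b hb => ⟨W'.1 ⊓ V, inf_le_left, ⟨hb, W.2 (h' hb)⟩, hde⟩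
    · exact density_ext_apply fun n k c x =>
        extendOp_apply_of_mem D W' s c ⟨x.1, x.2.1⟩ x.2.2
  · refine ⟨⟨U ⊓ ⟨(opSupport D.1)ᶜ, D.2.2.isClosed.isOpen_compl⟩, inf_le_left⟩,
      ⟨ha, fun hn => hV hn.1⟩, 0, fun W' h' => ?_⟩
    have : extendOp U D W' = 0 := LinearMap.ext fun s => density_ext_apply fun n k c x =>
      extendOp_apply_eq_zero D W' s c x (h' x.2).2
    rw [this]
    exact HasOrderLE.zero 0

end ExtendOp

end FormalManifold

namespace FormalManifold

open ComplexLRS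

variable {M : FormalManifold.{u}} (F : SheafOfModules.{u} M.ringSheaf)

/-! ### Functionals given by compactly supported operators -/

theorem rho_apply {U : M.Op} (D : Diffc F.val M.densitySheaf U) (s : Sec F.val U) :
    M.rho F U D s = integral (toDensity (applyTop D.1 s)) := rfl

/-- The extended operator applied to `s` is `D (s|_V)` on `V` and zero outside, so integration over
`U` reduces to integration over `V`. -/
theorem dualMap_rho_extendOp {V U : M.Op} (h : V ≤ U) (D : Diffc F.val M.densitySheaf V) :
    (Sec.res F.val h).dualMap (M.rho F V D) = M.rho F U ⟨extendOp U D, extendOp_mem h D⟩ := by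
  ext s
  refine (integral_eq_of_eqOn h (fun n k c x => ?_) fun n k c x hx =>
    extendOp_apply_of_notMem D ⟨U, le_rfl⟩ s c x hx).symm
  refine (extendOp_apply_of_mem D ⟨U, le_rfl⟩ s c ⟨x.1, h x.2⟩ x.2).trans ?_
  have h1 := D.2.1.1 ⟨U ⊓ V, inf_le_right⟩ ⟨V, le_rfl⟩ inf_le_right (Sec.res F.val h s)
  rw [Sec.res_res] at h1
  rw [h1]
  rfl

variable (M) in
theorem hasExtensions : M.HasExtensions F := by
  rintro V U h _ ⟨D, rfl⟩
  exact ⟨_, (dualMap_rho_extendOp F h D).symm⟩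

theorem dualMap_rho_restrictOp {V U : M.Op} (h : V ≤ U) (D : Diffc F.val M.densitySheaf U)
    (hV : opSupport D.1 ⊆ V) :
    (Sec.res F.val h).dualMap (M.rho F V ⟨restrictOp h D.1, restrictOp_mem h D.2 hV⟩) =
      M.rho F U D := by
  ext s
  refine (integral_eq_of_eqOn h (fun n k c x => ?_) fun n k c x hx =>
    toDensity_apply_eq_zero D.2.1.1 ⟨U, le_rfl⟩ s n k c x fun ha => hx (hV ha)).symm
  exact congrArg (fun d : Sec M.densitySheaf V => ((toDensity d).1 n k c).1 x)
    (D.2.1.1 ⟨V, h⟩ ⟨U, le_rfl⟩ h s).symm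

/-- The product of a compactly supported operator and a global section. -/
def mulDiffc {P : PresheafOfModules.{u} M.ringSheaf.obj} {U : M.Op}
    (D : Diffc P M.densitySheaf U) (f : M.O ⊤) : Diffc P M.densitySheaf U :=
  ⟨mulOp D.1 f, mulOp_mem D.2 f⟩

theorem rho_mulDiffc_apply {U : M.Op} (D : Diffc F.val M.densitySheaf U) (f : M.O ⊤)
    (s : Sec F.val U) :
    M.rho F U (mulDiffc D f) s = M.rho F U D (M.res (le_top : U ≤ ⊤) f • s) := rfl

/-- Already the densities `D (f s)` and `D s` coincide: near the support `f s = s` and `D` is local,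
while off the support both vanish. -/
theorem rho_mulDiffc_of_isOneNear {U : M.Op} (D : Diffc F.val M.densitySheaf U) {f : M.O ⊤}
    (hf : IsOneNear f (opSupport D.1)) : M.rho F U (mulDiffc D f) = M.rho F U D := by
  ext s
  rw [rho_mulDiffc_apply, rho_apply, rho_apply]
  congr 1
  refine density_ext_locally fun a ha => ?_
  by_cases hs : a ∈ opSupport D.1
  · obtain ⟨N, haN, hN⟩ := hf a hs
    refine ⟨U ⊓ N, inf_le_left, ⟨ha, haN⟩, ?_⟩
    have h1 := D.2.1.1 ⟨U ⊓ N, inf_le_left⟩ ⟨U, le_rfl⟩ inf_le_left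
    have h2 := congrArg (M.res (inf_le_right : U ⊓ N ≤ N)) hN
    rw [M.res_res, map_one] at h2
    refine (h1 _).symm.trans (Eq.trans ?_ (h1 s))
    rw [Sec.res_smul, M.res_res, h2, one_smul]
  · obtain ⟨N, haN, hN⟩ := exists_res_applyTop_eq_zero D.2.1.1 ha hs
    exact ⟨N.1, N.2, haN, (hN _).trans (hN s).symm⟩

theorem opSupport_mulDiffc_subset {P : PresheafOfModules.{u} M.ringSheaf.obj} {U V : M.Op}
    (D : Diffc P M.densitySheaf U) {f : M.O ⊤} (hf : IsSupportedIn f V) :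
    opSupport (mulDiffc D f).1 ⊆ V := by
  intro a ha
  by_contra hV
  obtain ⟨W, hVW, hW⟩ := hf
  have h1 : a ∈ V ⊔ W := hVW ▸ (trivial : a ∈ (⊤ : M.Op))
  exact notMem_opSupport_mulOp D.1 (h1.resolve_left hV) hW ha

/-- For a cutoff `f` that is `1` near the support of a representative, `η(s) = η(f s)`. The section
`f s` is the restriction of a global section, on which `η` vanishes. -/
theorem eq_zero_of_dualMap_eq_zero {V : M.Op} {η : Module.Dual ℂ (Sec F.val V)}
    (hη : η ∈ M.DcInf F V) (h0 : (Sec.res F.val (le_top : V ≤ ⊤)).dualMap η = 0) : η = 0 := by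
  obtain ⟨D, rfl⟩ := hη
  obtain ⟨f, hf, W, hVW, hW⟩ := exists_cutoff D.2.2 (V := V) fun _ ha => ha.1
  rw [← rho_mulDiffc_of_isOneNear F D hf]
  ext s
  obtain ⟨t, ht, -⟩ := Sec.exists_extend_zero F hVW (M.res (le_top : V ≤ ⊤) f • s) (by
    have h2 := congrArg (M.res (inf_le_right : V ⊓ W ≤ W)) hW
    rw [M.res_res, map_zero] at h2
    rw [Sec.res_smul, M.res_res, h2, zero_smul])
  rw [rho_mulDiffc_apply, ← ht]
  exact LinearMap.congr_fun h0 t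

/-! ### Functionals supported in an open set: intersections and unions -/

/-- The functionals on global sections which are given by compactly supported operators with
support in `U`. -/
def supportedDual (U : M.Op) : Submodule ℂ (Module.Dual ℂ (Sec F.val ⊤)) :=
  (M.DcInf F U).map (Sec.res F.val (le_top : U ≤ ⊤)).dualMap

variable {F}

theorem mem_supportedDual {U : M.Op} {η : Module.Dual ℂ (Sec F.val ⊤)} :
    η ∈ supportedDual F U ↔
      ∃ D : Diffc F.val M.densitySheaf ⊤, opSupport D.1 ⊆ U ∧ M.rho F ⊤ D = η := by
  constructor
  · rintro ⟨_, ⟨D, rfl⟩, rfl⟩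
    exact ⟨⟨extendOp ⊤ D, extendOp_mem le_top D⟩,
      (opSupport_extendOp ⊤ D).trans fun _ ha => ha.1, (dualMap_rho_extendOp F le_top D).symm⟩
  · rintro ⟨D, hD, rfl⟩
    exact ⟨_, ⟨_, rfl⟩, dualMap_rho_restrictOp F le_top D hD⟩

/-- Let `D` and `D'` represent `η` with supports in `U` and `V`, and let `f` be a cutoff for `D'`.
The identity `η(f s) = η(s)`, proved with `D'`, concerns the functional alone, so `D ∘ f` also
represents `η`; its support lies in `U ⊓ V`. -/
theorem supportedDual_inf_le (U V : M.Op) :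
    supportedDual F U ⊓ supportedDual F V ≤ supportedDual F (U ⊓ V) := by
  rintro η ⟨hU, hV⟩
  obtain ⟨D, hD, rfl⟩ := mem_supportedDual.1 hU
  obtain ⟨D', hD', h⟩ := mem_supportedDual.1 hV
  obtain ⟨f, hf, hfV⟩ := exists_cutoff D'.2.2 hD'
  refine mem_supportedDual.2 ⟨mulDiffc D f, fun a ha =>
    ⟨hD (opSupport_mulOp D.1 f ha), opSupport_mulDiffc_subset D hfV ha⟩, ?_⟩
  rw [← h, ← rho_mulDiffc_of_isOneNear F D' hf]
  ext s
  rw [rho_mulDiffc_apply, rho_mulDiffc_apply, h]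

/-- Split `D = D ∘ f + D ∘ (1 - f)`, where `f` is supported in `U` and is `1` near the compact set
`supp D \ V`. The second summand vanishes near that set, so its support lies in `V`. -/
theorem supportedDual_sup_le (U V : M.Op) :
    supportedDual F (U ⊔ V) ≤ supportedDual F U ⊔ supportedDual F V := by
  intro η hη
  obtain ⟨D, hD, rfl⟩ := mem_supportedDual.1 hη
  obtain ⟨f, hf, hfU⟩ := exists_cutoff (D.2.2.diff V.isOpen) (V := U)
    fun a ha => (hD ha.1).resolve_right ha.2
  refine Submodule.mem_sup.2 ⟨M.rho F ⊤ (mulDiffc D f),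
    mem_supportedDual.2 ⟨_, opSupport_mulDiffc_subset D hfU, rfl⟩,
    M.rho F ⊤ (mulDiffc D (1 - f)), mem_supportedDual.2 ⟨_, fun a ha => ?_, rfl⟩, ?_⟩
  · by_contra hV
    obtain ⟨N, haN, hN⟩ := hf a ⟨opSupport_mulOp D.1 _ ha, hV⟩
    exact notMem_opSupport_mulOp D.1 haN (by rw [map_sub, map_one, hN, sub_self]) ha
  · ext s
    rw [LinearMap.add_apply, rho_mulDiffc_apply, rho_mulDiffc_apply, ← map_add, ← add_smul,
      ← map_add, add_sub_cancel, map_one, one_smul]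

theorem supportedDual_bot : supportedDual F (⊥ : M.Op) = ⊥ := by
  refine eq_bot_iff.2 fun η hη => ?_
  obtain ⟨D, hD, rfl⟩ := mem_supportedDual.1 hη
  -- The support is empty, so even `f = 0` is `1` near it.
  rw [Submodule.mem_bot, ← rho_mulDiffc_of_isOneNear F D (f := 0) fun a ha => (hD ha).elim]
  ext s
  rw [rho_mulDiffc_apply, map_zero, zero_smul, map_zero, LinearMap.zero_apply]

/-- The support of an operator is compact, so finitely many members of `S` cover it, and the case of
two open sets applies inductively. -/
theorem supportedDual_sSup_le (S : Set M.Op) :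
    supportedDual F (sSup S) ≤ ⨆ U ∈ S, supportedDual F U := by
  intro η hη
  obtain ⟨D, hD, rfl⟩ := mem_supportedDual.1 hη
  obtain ⟨t, ht⟩ := D.2.2.elim_finite_subcover (fun U : S => (U.1 : Set M.space))
    (fun U => U.1.isOpen) fun a ha => by
      obtain ⟨U, hU, haU⟩ := Opens.mem_sSup.1 (hD ha)
      exact Set.mem_iUnion.2 ⟨⟨U, hU⟩, haU⟩
  have key (t : Finset S) : supportedDual F (t.sup fun U => U.1) ≤ ⨆ U ∈ S, supportedDual F U := by
    classical
    induction t using Finset.induction_on with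
    | empty => rw [Finset.sup_empty, supportedDual_bot]; exact bot_le
    | insert U t _ ih =>
      rw [Finset.sup_insert]
      exact (supportedDual_sup_le _ _).trans
        (sup_le (le_iSup₂_of_le U.1 U.2 le_rfl) ih)
  refine key t (mem_supportedDual.2 ⟨D, fun a ha => ?_, rfl⟩)
  obtain ⟨U, hU, haU⟩ := Set.mem_iUnion₂.1 (ht ha)
  exact Finset.le_sup (f := fun U : S => U.1) hU haU

end FormalManifold

/-! ### Precosheaves of submodules -/

section Cosheaf

variable {X : Type u} [TopologicalSpace X] {G : Opens X ⥤ ModuleCat.{u} ℂ}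

variable (G) in
/-- An embedding of a precosheaf into a module, compatible with the extension maps, such that the
images of the spaces `G(U)` are compatible with finite intersections and arbitrary unions. -/
structure LatticeEmbedding (H : Type u) [AddCommGroup H] [Module ℂ H] where
  toLin (U : Opens X) : G.obj U →ₗ[ℂ] H
  injective (U : Opens X) : Function.Injective (toLin U)
  map_apply {V U : Opens X} (h : V ≤ U) (x : G.obj V) :
    toLin U ((G.map (homOfLE h)).hom x) = toLin V x
  inf_le (U V : Opens X) : (toLin U).range ⊓ (toLin V).range ≤ (toLin (U ⊓ V)).range
  sSup_le (S : Set (Opens X)) : (toLin (sSup S)).range ≤ ⨆ U ∈ S, (toLin U).range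

namespace LatticeEmbedding

variable {H : Type u} [AddCommGroup H] [Module ℂ H]

theorem range_mono (θ : LatticeEmbedding G H) {V U : Opens X} (h : V ≤ U) :
    (θ.toLin V).range ≤ (θ.toLin U).range := by
  rintro _ ⟨x, rfl⟩
  exact ⟨_, θ.map_apply h x⟩

theorem iSup_le (θ : LatticeEmbedding G H) {ι : Type*} (U : ι → Opens X) :
    (θ.toLin (⨆ i, U i)).range ≤ ⨆ i, (θ.toLin (U i)).range := by
  refine (θ.sSup_le (Set.range U)).trans ?_
  rw [iSup_range]

theorem isFlabby (θ : LatticeEmbedding G H) : IsFlabby G := fun V U h x y hxy => θ.injective V (by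
  rw [← θ.map_apply h, hxy, θ.map_apply])

/-- If `a + b = 0` in `H`, then `a = -b` lies in the images of both `G(U₁)` and `G(U₂)`, hence in
that of `G(U₁ ⊓ U₂)`. -/
theorem mayerVietorisExact (θ : LatticeEmbedding G H) : MayerVietorisExact G := by
  refine fun U₁ U₂ => ⟨fun ⟨a, b⟩ => ⟨fun h => ?_, ?_⟩, fun x => ?_⟩
  · have h1 := congrArg (θ.toLin _) h
    rw [LinearMap.coprod_apply, map_add, map_zero, θ.map_apply, θ.map_apply] at h1
    obtain ⟨z, hz⟩ := θ.inf_le U₁ U₂ (x := θ.toLin U₁ a)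
      ⟨⟨a, rfl⟩, ⟨-b, by rw [map_neg]; exact (eq_neg_of_add_eq_zero_left h1).symm⟩⟩
    refine ⟨z, Prod.ext (θ.injective _ ?_) (θ.injective _ ?_)⟩
    · exact (θ.map_apply inf_le_left z).trans hz
    · refine (map_neg (θ.toLin U₂) _).trans ?_
      rw [θ.map_apply, hz]
      exact (eq_neg_of_add_eq_zero_right h1).symm
  · rintro ⟨z, hz⟩
    rw [← hz]
    refine θ.injective _ ?_
    rw [LinearMap.coprod_apply, map_add, map_zero, θ.map_apply, θ.map_apply]
    change θ.toLin U₁ ((G.map (homOfLE inf_le_left)).hom z) +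
      θ.toLin U₂ (-(G.map (homOfLE inf_le_right)).hom z) = 0
    rw [map_neg, θ.map_apply, θ.map_apply, add_neg_cancel]
  · have h1 := θ.sSup_le {U₁, U₂}
    rw [sSup_pair, iSup_pair] at h1
    obtain ⟨_, ⟨a, rfl⟩, _, ⟨b, rfl⟩, hab⟩ := Submodule.mem_sup.1 (h1 ⟨x, rfl⟩)
    refine ⟨(a, b), θ.injective _ ?_⟩
    rw [LinearMap.coprod_apply, map_add, θ.map_apply, θ.map_apply, hab]

open scoped DirectSum Classical in
theorem toLin_coverSum_lof (θ : LatticeEmbedding G H) {ι : Type w} (U : ι → Opens X) (i : ι) (a : G.obj (U i)) :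
    θ.toLin _ (coverSum G U (DirectSum.lof ℂ ι (fun i => G.obj (U i)) i a)) =
      θ.toLin (U i) a := by
  rw [coverSum, DirectSum.toModule_lof, θ.map_apply]

open scoped DirectSum Classical in
theorem coverDiff_lof {ι : Type w} (U : ι → Opens X) (i j : ι) (a : G.obj (U i ⊓ U j)) :
    coverDiff G U (DirectSum.lof ℂ (ι × ι) (fun p => G.obj (U p.1 ⊓ U p.2)) (i, j) a) =
      DirectSum.lof ℂ ι (fun i => G.obj (U i)) i ((G.map (homOfLE inf_le_left)).hom a) -
      DirectSum.lof ℂ ι (fun i => G.obj (U i)) j ((G.map (homOfLE inf_le_right)).hom a) := by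
  rw [coverDiff, DirectSum.toModule_lof]
  rfl

open scoped DirectSum Classical in
theorem coverSum_comp_coverDiff (θ : LatticeEmbedding G H) {ι : Type w} (U : ι → Opens X) :
    coverSum G U ∘ₗ coverDiff G U = 0 := by
  refine DirectSum.linearMap_ext ℂ fun p => LinearMap.ext fun a => θ.injective _ ?_
  change θ.toLin _ (coverSum G U (coverDiff G U (DirectSum.lof ℂ (ι × ι)
    (fun p => G.obj (U p.1 ⊓ U p.2)) (p.1, p.2) a))) = _
  rw [coverDiff_lof, map_sub, map_sub, θ.toLin_coverSum_lof, θ.toLin_coverSum_lof, θ.map_apply,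
    θ.map_apply, sub_self]
  exact (map_zero _).symm

open scoped DirectSum Classical in
-- Induction on the set of indices that carry `x`. The component at `i₀` is minus the sum of the
-- others in `H`, so it lies in the image of `G(U i₀ ⊓ ⋃ U i)`, the union being over `i ∈ t`. It is
-- therefore a sum of elements coming from the `G(U i₀ ⊓ U i)`, and subtracting the corresponding
-- differences moves it to the indices in `t`.
theorem mem_range_coverDiff (θ : LatticeEmbedding G H) {ι : Type w} (U : ι → Opens X) (t : Finset ι) (x : ⨁ i, G.obj (U i))
    (hx : x ∈ ⨆ i ∈ t, (DirectSum.lof ℂ ι (fun i => G.obj (U i)) i).range)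
    (h0 : coverSum G U x = 0) : x ∈ (coverDiff G U).range := by
  induction t using Finset.induction_on generalizing x with
  | empty =>
    have : x = 0 := by simpa using hx
    rw [this]
    exact zero_mem _
  | insert i₀ t _ ih =>
    rw [Finset.iSup_insert] at hx
    obtain ⟨_, ⟨a, rfl⟩, x', hx', rfl⟩ := Submodule.mem_sup.1 hx
    have h1 : θ.toLin _ (coverSum G U x') ∈ (θ.toLin (⨆ i : t, U i)).range := by
      have : (⨆ i ∈ t, (DirectSum.lof ℂ ι (fun i => G.obj (U i)) i).range) ≤
          (θ.toLin (⨆ i : t, U i)).range.comap (θ.toLin _ ∘ₗ coverSum G U) := by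
        refine iSup₂_le fun i hi => ?_
        rintro _ ⟨b, rfl⟩
        refine Submodule.mem_comap.2 ?_
        rw [LinearMap.comp_apply, θ.toLin_coverSum_lof]
        exact θ.range_mono (le_iSup (fun i : t => U i) ⟨i, hi⟩) ⟨b, rfl⟩
      exact this hx'
    have h2 : θ.toLin (U i₀) a = -θ.toLin _ (coverSum G U x') := by
      have := congrArg (θ.toLin _) h0
      rw [map_add, map_add, map_zero, θ.toLin_coverSum_lof] at this
      exact eq_neg_of_add_eq_zero_left this
    have h3 : θ.toLin (U i₀) a ∈ ⨆ i : t, (θ.toLin (U i₀ ⊓ U i)).range := by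
      refine θ.iSup_le (fun i : t => U i₀ ⊓ U i) ?_
      -- Distributivity of the lattice of open sets enters here.
      rw [← inf_iSup_eq]
      exact θ.inf_le _ _ ⟨⟨a, rfl⟩, h2 ▸ neg_mem h1⟩
    set T := ⨆ i ∈ t, (DirectSum.lof ℂ ι (fun i => G.obj (U i)) i).range
    let lof₀ := DirectSum.lof ℂ ι (fun i => G.obj (U i)) i₀
    -- The pairs `(a', y)` with `y` carried by `t` and `lof₀ a' - y` in the range of `coverDiff`
    -- form a submodule. Stating the existence of `y` through its image lets it be checked on one
    -- intersection at a time.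
    have h4 : (⨆ i : t, (θ.toLin (U i₀ ⊓ U i)).range) ≤
        (T.comap (LinearMap.snd ℂ (G.obj (U i₀)) _) ⊓ (coverDiff G U).range.comap
          (lof₀ ∘ₗ LinearMap.fst ℂ _ _ - LinearMap.snd ℂ _ _)).map
            (θ.toLin (U i₀) ∘ₗ LinearMap.fst ℂ _ _) := by
      refine _root_.iSup_le fun i => ?_
      rintro _ ⟨b, rfl⟩
      refine ⟨((G.map (homOfLE inf_le_left)).hom b, DirectSum.lof ℂ ι (fun i => G.obj (U i)) i.1
        ((G.map (homOfLE inf_le_right)).hom b)), ⟨?_, ?_⟩, θ.map_apply inf_le_left b⟩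
      · exact Submodule.mem_iSup_of_mem i.1 (Submodule.mem_iSup_of_mem i.2 ⟨_, rfl⟩)
      · exact ⟨_, coverDiff_lof U i₀ i.1 b⟩
    obtain ⟨⟨a', y⟩, ⟨hy, hay⟩, ha⟩ := h4 h3
    obtain rfl : a' = a := θ.injective _ ha
    have hay' : lof₀ a' - y ∈ (coverDiff G U).range := hay
    have h5 : lof₀ a' + x' = (lof₀ a' - y) + (y + x') := by abel
    change lof₀ a' + x' ∈ _
    rw [h5]
    refine add_mem hay' (ih _ (add_mem hy hx') ?_)
    obtain ⟨z, hz⟩ := hay'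
    have h6 : coverSum G U (lof₀ a' - y) = 0 := by
      rw [← hz]
      exact LinearMap.congr_fun (θ.coverSum_comp_coverDiff U) z
    change coverSum G U (lof₀ a' + x') = 0 at h0
    rwa [h5, map_add, h6, zero_add] at h0

open scoped DirectSum Classical in
theorem isCosheaf (θ : LatticeEmbedding G H) : IsCosheaf.{u, w} G := by
  refine fun ι U => ⟨fun x => ⟨fun h => ?_, ?_⟩, fun x => ?_⟩
  · refine θ.mem_range_coverDiff U (DFinsupp.support x) x ?_ h
    have h1 : ∑ i ∈ DFinsupp.support x, DirectSum.of (fun i => G.obj (U i)) i (x i) ∈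
        ⨆ i ∈ DFinsupp.support x, (DirectSum.lof ℂ ι (fun i => G.obj (U i)) i).range :=
      sum_mem fun i hi =>
        Submodule.mem_iSup_of_mem i (Submodule.mem_iSup_of_mem hi ⟨x i, rfl⟩)
    rwa [DirectSum.sum_support_of x] at h1
  · rintro ⟨y, rfl⟩
    exact LinearMap.congr_fun (θ.coverSum_comp_coverDiff U) y
  · have h1 : (⨆ i, (θ.toLin (U i)).range) ≤ (θ.toLin _ ∘ₗ coverSum G U).range := by
      refine _root_.iSup_le fun i => ?_
      rintro _ ⟨b, rfl⟩
      exact ⟨_, θ.toLin_coverSum_lof U i b⟩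
    obtain ⟨y, hy⟩ := h1 (θ.iSup_le U ⟨x, rfl⟩)
    exact ⟨y, θ.injective _ hy⟩

/-- A directed sum of subspaces is their union, so each element over the union comes from a single
member of `S`. Any two representatives agree in a common larger member, since they have the same
image in `H`. -/
theorem preservesDirectedUnions (θ : LatticeEmbedding G H) : PreservesDirectedUnions G := by
  intro S hS
  rcases S.eq_empty_or_nonempty with rfl | hne
  -- `DirectedOn` admits the empty family. Its union is the empty set, where `G` vanishes because an
  -- empty supremum of subspaces is zero.
  · have h0 (x : (unionCocone G ∅).pt) : x = 0 := by
      have h1 := θ.sSup_le ∅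
      have h2 : (⨆ U ∈ (∅ : Set (Opens X)), (θ.toLin U).range) = ⊥ := by simp
      rw [h2] at h1
      have h3 : θ.toLin (sSup ∅) x = 0 := (Submodule.mem_bot ℂ).1 (h1 ⟨x, rfl⟩)
      exact θ.injective (sSup ∅) (h3.trans (map_zero _).symm)
    exact ⟨{
      desc := fun s => 0
      fac := fun s j => j.2.elim
      uniq := fun s m _ => ModuleCat.hom_ext (LinearMap.ext fun x => by
        rw [h0 x, map_zero, map_zero]) }⟩
  · have : Nonempty S := hne.to_subtype
    have : IsDirectedOrder S := directedOn_iff_isDirectedOrder.1 hS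
    have hrep (x : G.obj (sSup S)) : ∃ (U : S) (y : G.obj U.1), θ.toLin U.1 y = θ.toLin _ x := by
      have h1 : θ.toLin (sSup S) x ∈ ⨆ U : S, (θ.toLin U.1).range := by
        rw [iSup_subtype]
        exact θ.sSup_le S ⟨x, rfl⟩
      rw [Submodule.mem_iSup_of_directed _ fun U V => by
        obtain ⟨Z, hU, hV⟩ := exists_ge_ge U V
        exact ⟨Z, θ.range_mono hU, θ.range_mono hV⟩] at h1
      exact h1
    choose U y hy using hrep
    let K := (Subtype.mono_coe (· ∈ S)).functor ⋙ G
    let leg (s : Limits.Cocone K) (V : S) : G.obj V.1 →ₗ[ℂ] s.pt := (s.ι.app V).hom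
    have hleg (s : Limits.Cocone K) {V Z : S} (h : V ≤ Z) (a : G.obj V.1) :
        leg s Z ((G.map (homOfLE h)).hom a) = leg s V a :=
      congrArg (fun g : K.obj V ⟶ s.pt => g.hom a) (s.w (homOfLE h))
    -- A leg of a cocone depends only on the image in `H`; this makes the map built from the chosen
    -- representatives linear and compatible with the legs.
    have key (s : Limits.Cocone K) {V Z : S} (a : G.obj V.1) (b : G.obj Z.1)
        (hab : θ.toLin V.1 a = θ.toLin Z.1 b) : leg s V a = leg s Z b := by
      obtain ⟨T, hV, hZ⟩ := exists_ge_ge V Z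
      rw [← hleg s hV, ← hleg s hZ]
      congr 1
      refine θ.injective _ ?_
      rw [θ.map_apply, θ.map_apply, hab]
    exact ⟨{
      desc := fun s => ModuleCat.ofHom (Y := s.pt)
        { toFun := fun x => leg s (U x) (y x)
          map_add' := fun a b => by
            obtain ⟨T, ha, hb⟩ := exists_ge_ge (U a) (U b)
            rw [← hleg s ha, ← hleg s hb, ← map_add]
            refine key s _ _ ?_
            rw [map_add, θ.map_apply, θ.map_apply, hy, hy, hy, map_add]
          map_smul' := fun z a => by
            rw [RingHom.id_apply, ← map_smul]
            refine key s _ _ ?_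
            rw [map_smul, hy, hy, map_smul] }
      fac := fun s V => ModuleCat.hom_ext (LinearMap.ext fun a =>
        key s (V := U ((G.map (homOfLE (le_sSup V.2))).hom a)) _ a
          ((hy _).trans (θ.map_apply (le_sSup V.2) a)))
      uniq := fun s m hm => ModuleCat.hom_ext (LinearMap.ext fun x => by
        have h1 : (G.map (homOfLE (le_sSup (U x).2))).hom (y x) = x :=
          θ.injective _ ((θ.map_apply _ _).trans (hy x))
        have h2 : m.hom ((G.map (homOfLE (le_sSup (U x).2))).hom (y x)) = leg s (U x) (y x) :=
          congrArg (fun g : K.obj (U x) ⟶ s.pt => g.hom (y x)) (hm (U x))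
        rw [h1] at h2
        exact h2) }⟩

end LatticeEmbedding

end Cosheaf

theorem ComplexLRS.Chart.red_lift {Y : ComplexLRS.{u}} {n k : ℕ} (c : Y.Chart n k)
    {W : Opens (E n)} (g : smoothFun W) (x : c.pre (ComplexLRS.openImage c.isOpenEmbedding W))
    (hx : x.1 ∈ W) : (c.red _ (c.lift g)).1 x = g.1 ⟨x.1, hx⟩ := by
  -- The two open sets are equal but not definitionally so; restricting along the inclusion avoids
  -- transporting along the equality.
  have h : c.pre (ComplexLRS.openImage c.isOpenEmbedding W) ≤ W := (c.pre_openImage W).le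
  have h1 := congrArg (fun f => (MvPowerSeries.constantCoeff (c.iso _ f)).1 x) (c.res_lift h g)
  refine h1.trans ?_
  simp only [ComplexLRS.Chart.lift, AlgEquiv.apply_symm_apply, MvPowerSeries.constantCoeff_C]
  rfl

namespace FormalManifold

open ComplexLRS

variable {M : FormalManifold.{u}}

/-! ### From densities to functions in a chart -/

theorem value_mul {V : M.Op} (f g : M.O V) (a : V) :
    M.value (f * g) a = M.value f a * M.value g a := by
  obtain ⟨φ, hφ⟩ := exists_value_eq a
  rw [hφ, hφ, hφ, map_mul]

theorem value_zero {V : M.Op} (a : V) : M.value (0 : M.O V) a = 0 := by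
  obtain ⟨φ, hφ⟩ := exists_value_eq a
  rw [hφ, map_zero]

theorem value_one {V : M.Op} (a : V) : M.value (1 : M.O V) a = 1 := by
  obtain ⟨φ, hφ⟩ := exists_value_eq a
  rw [hφ, map_one]

section ChartFun

variable {n k : ℕ} (c : M.Chart n k) (f : M.O ⊤)

/-- The function `f · d_c` on `W`, where `d_c` is the coefficient of the density `d` in the chart
`c`, extended by zero. -/
def chartFunAux {W : M.Op} (d : M.Density W) (a : W) : ℂ :=
  M.value f ⟨a.1, trivial⟩ *
    Function.extend (fun x : c.pre W => (⟨c.param x.1, x.2⟩ : W)) (d.1 n k c).1 0 a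

variable {c f}

theorem chartFunAux_apply {W : M.Op} (d : M.Density W) (x : c.pre W) :
    chartFunAux c f d ⟨c.param x.1, x.2⟩ =
      M.value f ⟨c.param x.1, trivial⟩ * (d.1 n k c).1 x := by
  have hinj : Function.Injective fun x : c.pre W => (⟨c.param x.1, x.2⟩ : W) := fun x y h =>
    Subtype.ext (c.isOpenEmbedding.injective (congrArg Subtype.val h))
  exact congrArg (_ * ·) (hinj.extend_apply _ _ x)

theorem chartFunAux_of_notMem {W : M.Op} (d : M.Density W) (a : W)
    (ha : a.1 ∉ Set.range c.param) : chartFunAux c f d a = 0 := by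
  rw [chartFunAux, Function.extend_apply' _ _ _ fun ⟨y, hy⟩ => ha ⟨y.1, congrArg Subtype.val hy⟩]
  exact mul_zero _

theorem exists_eq_param_or_notMem_range (c : M.Chart n k) {W : M.Op} (a : W) :
    (∃ x : c.pre W, a = ⟨c.param x.1, x.2⟩) ∨ a.1 ∉ Set.range c.param := by
  refine or_iff_not_imp_right.2 fun ha => ?_
  obtain ⟨a, haW⟩ := a
  obtain ⟨x, rfl⟩ := not_not.1 ha
  exact ⟨⟨x, haW⟩, rfl⟩

/-- Smoothness in another chart is obtained without differentiating transition maps: the coefficient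
`d_c` lifts to a section of the structure sheaf over the chart domain, and the values of such a
section are smooth in every chart. Away from the chart domain `f` vanishes. -/
theorem chartFunAux_mem (hf : IsSupportedIn f (openImage c.isOpenEmbedding ⊤)) {W : M.Op}
    (d : M.Density W) : chartFunAux c f d ∈ M.RedFun W := by
  intro n' k' c'
  refine mem_smoothFun_of_locally fun x => ?_
  obtain ⟨Z, hZ, hfZ⟩ := hf
  have hx : c'.param x.1 ∈ openImage c.isOpenEmbedding ⊤ ⊔ Z := hZ ▸ trivial
  rcases hx with ⟨z, -, hz⟩ | hx
  · let N := openImage c.isOpenEmbedding (c.pre W)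
    have hzW : z ∈ c.pre W := by
      change c.param z ∈ W
      rw [hz]
      exact x.2
    refine ⟨c'.pre N, c'.pre_mono (c.image_pre_le W), ⟨z, hzW, hz⟩, ?_⟩
    convert (c'.red N (M.res le_top f * c.lift (d.1 n k c))).2 using 1
    funext y
    rw [← c'.value_param, value_mul, value_res]
    obtain ⟨v, hv, hvy⟩ := y.2
    have hN : c.param v ∈ N := ⟨v, hv, rfl⟩
    have h1 := (c.value_param (c.lift (d.1 n k c)) ⟨v, hN⟩).trans (c.red_lift _ _ hv)
    have h2 : (⟨c'.param y.1, y.2⟩ : N) = ⟨c.param v, hN⟩ := Subtype.ext hvy.symm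
    have h3 : (⟨c'.param y.1, c.image_pre_le W y.2⟩ : W) = ⟨c.param v, hv⟩ := Subtype.ext hvy.symm
    rw [h2, h1]
    exact (congrArg (chartFunAux c f d) h3).trans (chartFunAux_apply d ⟨v, hv⟩)
  · refine ⟨c'.pre (W ⊓ Z), c'.pre_mono inf_le_left, ⟨x.2, hx⟩, ?_⟩
    convert zero_mem (smoothFun (c'.pre (W ⊓ Z))) using 1
    funext y
    have h1 := value_res (le_top : Z ≤ ⊤) f ⟨c'.param y.1, y.2.2⟩
    rw [hfZ, value_zero] at h1
    change M.value f ⟨c'.param y.1, trivial⟩ * _ = 0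
    rw [← h1, zero_mul]

theorem chartFunAux_smul {W : M.Op} (g : M.O W) (d : M.Density W) (a : W) :
    chartFunAux c f (g • d) a = M.value g a * chartFunAux c f d a := by
  rcases exists_eq_param_or_notMem_range c a with ⟨x, rfl⟩ | ha
  · rw [chartFunAux_apply, chartFunAux_apply, c.value_param g x, mul_left_comm]
    rfl
  · rw [chartFunAux_of_notMem _ _ ha, chartFunAux_of_notMem _ _ ha, mul_zero]

theorem chartFunAux_res {V W : M.Op} (h : V ≤ W) (d : M.Density W) (a : V) :
    chartFunAux c f (Density.res M h d) a = chartFunAux c f d ⟨a.1, h a.2⟩ := by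
  rcases exists_eq_param_or_notMem_range c a with ⟨x, rfl⟩ | ha
  · exact (chartFunAux_apply _ x).trans (chartFunAux_apply d ⟨x.1, h x.2⟩).symm
  · exact (chartFunAux_of_notMem _ _ ha).trans (chartFunAux_of_notMem d ⟨a.1, h a.2⟩ ha).symm

/-- The linear map `d ↦ f · d_c` from densities to functions. -/
def chartFun (hf : IsSupportedIn f (openImage c.isOpenEmbedding ⊤)) (W : M.Op) :
    Sec M.densitySheaf W →ₗ[ℂ] Sec M.redSheaf W where
  toFun d := show M.RedFun W from ⟨chartFunAux c f (toDensity d), chartFunAux_mem hf _⟩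
  map_add' d e := Subtype.ext (funext fun a => by
    change chartFunAux c f (toDensity d + toDensity e) a =
      chartFunAux c f (toDensity d) a + chartFunAux c f (toDensity e) a
    rcases exists_eq_param_or_notMem_range c a with ⟨x, rfl⟩ | ha
    · rw [chartFunAux_apply, chartFunAux_apply, chartFunAux_apply, ← mul_add]
      rfl
    · rw [chartFunAux_of_notMem _ _ ha, chartFunAux_of_notMem _ _ ha,
        chartFunAux_of_notMem _ _ ha, add_zero])
  map_smul' z d := Subtype.ext (funext fun a =>
    chartFunAux_smul (algebraMap ℂ (M.O W) z) (toDensity d) a)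

variable {P : PresheafOfModules.{u} M.ringSheaf.obj} {U : M.Op}

/-- `chartFun` is `𝒪`-linear and commutes with restriction, so it preserves local finite order and
does not enlarge supports. The composite thus indexes a seminorm of the smooth topology. -/
theorem comp_chartFun_mem (hf : IsSupportedIn f (openImage c.isOpenEmbedding ⊤))
    (D : Diffc P M.densitySheaf U) :
    (fun W => chartFun hf W.1 ∘ₗ D.1 W : OpFamily P M.redSheaf U) ∈ Diffc P M.redSheaf U := by
  refine ⟨⟨fun W' W h s => ?_, fun a ha => ?_⟩,
    isCompact_opSupport D.2.2 (fun _ ha => ha.1) fun a ha => ⟨ha.1, fun W haW hW =>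
      ha.2 W haW fun W' h' => ?_⟩⟩
  · change chartFun hf W'.1 (D.1 W' _) = _
    rw [D.2.1.1 W' W h s]
    exact Subtype.ext (funext fun a => chartFunAux_res h _ a)
  · obtain ⟨W, haW, r, hr⟩ := D.2.1.2 a ha
    exact ⟨W, haW, r, fun W' h' => (hr W' h').comp_left _ fun g d =>
      Subtype.ext (funext fun a => chartFunAux_smul g (toDensity d) a)⟩
  · change chartFun hf W'.1 ∘ₗ D.1 W' = 0
    rw [hW W' h', LinearMap.comp_zero]

end ChartFun

/-! ### Continuity -/

section Continuity

variable (F : SheafOfModules.{u} M.ringSheaf) {U : M.Op}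

/-- The integrals of the pieces of `D s` are bounded by seminorms of the smooth topology. -/
theorem exists_norm_integral_localDensity_le (D : Diffc F.val M.densitySheaf U)
    (i : M.AllCharts) : ∃ (D' : Diffc F.val M.redSheaf U) (C : NNReal), ∀ s,
      ‖∫ x, localDensity (toDensity (applyTop D.1 s)) i x‖ ≤ C * M.smoothSeminorm F.val U D' s := by
  have hsub : tsupport (M.pou i) ⊆ Set.range i.2.2.param :=
    M.exists_partitionOfUnity.choose_spec i
  have hK : IsCompact (opSupport D.1 ∩ tsupport (M.pou i)) :=
    D.2.2.inter_right (isClosed_tsupport _)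
  have hS : IsCompact (i.2.2.param ⁻¹' (opSupport D.1 ∩ tsupport (M.pou i))) :=
    (i.2.2.isOpenEmbedding.isInducing.isCompact_preimage_iff
      (Set.inter_subset_right.trans hsub)).2 hK
  -- The compact set contains every point where `ψᵢ D s` can be nonzero, whatever `s` is. There `f =
  -- 1`, so `chartFun` returns the coefficient of `D s` itself; the constant `C` is the volume of
  -- its preimage in the chart.
  obtain ⟨f, hf1, hf⟩ := exists_cutoff hK (V := openImage i.2.2.isOpenEmbedding ⊤)
    (Set.inter_subset_right.trans (hsub.trans Set.image_univ.symm.subset))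
  refine ⟨⟨_, comp_chartFun_mem hf D⟩, ⟨_, MeasureTheory.measureReal_nonneg
    (μ := MeasureTheory.volume) (s := i.2.2.param ⁻¹' (opSupport D.1 ∩ tsupport (M.pou i)))⟩,
    fun s => ?_⟩
  have hzero := localDensity_eq_zero (toDensity (applyTop D.1 s)) (K := opSupport D.1)
    (fun n k c x hx => toDensity_apply_eq_zero D.2.1.1 ⟨U, le_rfl⟩ s n k c x hx) i
  rw [← MeasureTheory.setIntegral_eq_integral_of_forall_compl_eq_zero hzero, mul_comm]
  refine MeasureTheory.norm_setIntegral_le_of_norm_le_const hS.measure_lt_top fun x hx => ?_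
  have hxU : i.2.2.param x ∈ U := hx.1.1
  refine le_trans ?_ (le_ciSup (M.bddAbove_range_applyTop F.val U ⟨_, comp_chartFun_mem hf D⟩ s)
    ⟨i.2.2.param x, hxU⟩)
  have h1 : toFun (applyTop (fun W => chartFun hf W.1 ∘ₗ D.1 W : OpFamily F.val M.redSheaf U) s)
      ⟨i.2.2.param x, hxU⟩ = M.value f ⟨i.2.2.param x, trivial⟩ *
        ((toDensity (applyTop D.1 s)).1 i.1 i.2.1 i.2.2).1 ⟨x, hxU⟩ :=
    chartFunAux_apply (toDensity (applyTop D.1 s)) ⟨x, hxU⟩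
  obtain ⟨N, hxN, hN⟩ := hf1 _ hx
  have h2 := value_res (le_top : N ≤ ⊤) f ⟨i.2.2.param x, hxN⟩
  rw [hN, value_one] at h2
  rw [← h2, one_mul] at h1
  refine le_of_le_of_eq ?_ (congrArg norm h1).symm
  have h3 : Function.extend Subtype.val
      ((toDensity (applyTop D.1 s)).1 i.1 i.2.1 i.2.2).1 0 x =
        ((toDensity (applyTop D.1 s)).1 i.1 i.2.1 i.2.2).1 ⟨x, hxU⟩ :=
    Subtype.val_injective.extend_apply _ _ (⟨x, hxU⟩ : i.2.2.pre U)
  rw [localDensity, h3, norm_mul, Complex.norm_real, Real.norm_of_nonneg (M.pou.nonneg i _)]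
  exact mul_le_of_le_one_left (norm_nonneg _) (M.pou.le_one i _)

/-- The compact support of `D` meets the supports of only finitely many members of the partition of
unity. This finite set does not depend on `s`, so finitely many seminorms bound the functional. -/
theorem rho_mem_contDual (D : Diffc F.val M.densitySheaf U) :
    M.rho F U D ∈ M.contDual F.val U := by
  classical
  choose D' C hC using exists_norm_integral_localDensity_le F D
  have hfin := M.pou.locallyFinite_tsupport.finite_nonempty_inter_compact D.2.2
  have hsum (s : Sec F.val U) : M.rho F U D s = ∑ i ∈ hfin.toFinset,
      ∫ x, localDensity (toDensity (applyTop D.1 s)) i x := by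
    refine finsum_eq_sum_of_support_subset _ fun i hi => hfin.mem_toFinset.2 ?_
    by_contra hn
    refine hi ?_
    have h0 : localDensity (toDensity (applyTop D.1 s)) i = 0 := funext fun x =>
      localDensity_eq_zero _ (fun n k c x hx => toDensity_apply_eq_zero D.2.1.1 ⟨U, le_rfl⟩
        s n k c x hx) i x fun hx => hn ⟨_, hx.2, hx.1⟩
    simp [h0]
  let := M.smoothTopology F.val U
  have hp : WithSeminorms (M.smoothSeminorm F.val U) := ⟨rfl⟩
  refine hp.continuous_normedSpace_rng ℂ (M.rho F U D)
    ⟨hfin.toFinset.image D', ∑ i ∈ hfin.toFinset, C i, fun s => ?_⟩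
  change ‖M.rho F U D s‖ ≤ ((∑ i ∈ hfin.toFinset, C i : NNReal) : ℝ) * _
  rw [hsum, NNReal.coe_sum, Finset.sum_mul]
  refine norm_sum_le_of_le _ fun i hi => (hC i s).trans ?_
  gcongr
  exact Seminorm.le_finset_sup_apply (Finset.mem_image_of_mem D' hi)

end Continuity

/-! ### The embedding into the dual of the global sections, and the theorem -/

/-- The precosheaf of compactly supported formal densities, embedded into the functionals on global
sections. -/
def dcInfEmbedding (F : SheafOfModules.{u} M.ringSheaf) :
    LatticeEmbedding (M.DcInfPrecosheaf F (M.hasExtensions F)) (Module.Dual ℂ (Sec F.val ⊤)) :=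
  have hrange (U : M.Op) : ((Sec.res F.val (le_top : U ≤ ⊤)).dualMap ∘ₗ
      (M.DcInf F U).subtype).range = supportedDual F U := by
    rw [LinearMap.range_comp, Submodule.range_subtype]
    rfl
  { toLin := fun U => (Sec.res F.val (le_top : U ≤ ⊤)).dualMap ∘ₗ (M.DcInf F U).subtype
    injective := fun U => (injective_iff_map_eq_zero _).2 fun η h =>
      Subtype.ext (eq_zero_of_dualMap_eq_zero F η.2 h)
    map_apply := fun {V U} h η => LinearMap.ext fun s =>
      congrArg η.1 (Sec.res_res F.val h le_top s)
    inf_le := fun U V => (inf_le_inf (hrange U).le (hrange V).le).trans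
      ((supportedDual_inf_le U V).trans (hrange _).ge)
    sSup_le := fun S => (hrange _).le.trans
      ((supportedDual_sSup_le S).trans (iSup₂_mono fun U _ => (hrange U).ge)) }

end FormalManifold

end FormalMfd

end

theorem mainTheorem4 (M : FormalMfd.FormalManifold.{u}) (F : SheafOfModules.{u} M.ringSheaf) :
    (∀ U : M.Op, M.DcInf F U ≤ M.contDual F.val U) ∧
    ∃ h : M.HasExtensions F,
      FormalMfd.IsCosheaf.{u, w} (M.DcInfPrecosheaf F h) ∧
      FormalMfd.IsFlabby (M.DcInfPrecosheaf F h) ∧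
      FormalMfd.MayerVietorisExact (M.DcInfPrecosheaf F h) ∧
      FormalMfd.PreservesDirectedUnions (M.DcInfPrecosheaf F h) := by
  let θ := FormalMfd.FormalManifold.dcInfEmbedding F
  refine ⟨fun U => ?_, M.hasExtensions F, θ.isCosheaf, θ.isFlabby, θ.mayerVietorisExact,
    θ.preservesDirectedUnions⟩
  rintro _ ⟨D, rfl⟩
  exact FormalMfd.FormalManifold.rho_mem_contDual F D
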